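/- **Setting.** Let $M$ be a smooth ($C^\infty$, Hausdorff) manifold without boundary, of dimension $d=\dim M\neq 1$. Let $E\to M$ be an exact Courant algebroid, i.e. a smooth vector bundle of finite rank with a nondegenerate symmetric pairing $\langle\cdot,\cdot\rangle$, an anchor $\pi:E\to TM$ and an $\mathbb R$-bilinear bracket $[\cdot,\cdot]$ on $\Gamma(E)$ such that $[u,[v,w]]=[[u,v],w]+[v,[u,w]]$, $\ \pi[u,v]=[\pi u,\pi v]$, $\ [u,fv]=f[u,v]+\pi(u)(f)\,v$, $\ \pi(u)\langle v,w\rangle=\langle[u,v],w\rangle+\langle v,[u,w]\rangle$, $\ \langle[u,u],v\rangle=\tfrac12\pi(v)\langle u,u\rangle$, and such that $0\to T^*M\to E\xrightarrow{\pi}TM\to0$ (the first map being the transpose of $\pi$) is exact. Let $\mathcal G(u,v)=\langle\tau u,v\rangle$ be a semi-Riemannian generalised metric: $\tau$ is a smooth endomorphism of $E$ with $\tau^2=1$, $\mathcal G$ is symmetric, and $\mathcal G$ is nondegenerate on $T^*M=\ker\pi$. Put $E_\pm=\ker(\tau\mp1)$, so that $E=E_+\oplus E_-$ and $\pi:E_\pm\to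 TM$ is an isomorphism; write $u_\pm$ for the $E_\pm$-component of $u\in E$, and $X^\pm\in E_\pm$ for the lift of $X\in TM$. Throughout, upper signs go together and lower signs go together. * $g(X,Y)=\langle X^+,Y^+\rangle=-\langle X^-,Y^-\rangle$ is the induced semi-Riemannian metric on $M$, $\nabla$ its Levi-Civita connection, and $\mathrm{Rm}(X,Y,Z,W)=g\big((\nabla_Z\nabla_W-\nabla_W\nabla_Z-\nabla_{[Z,W]})Y,X\big)$. * $\sigma X=\frac12(X^++X^-)$, $\ H(X,Y,Z)=2\langle[\sigma X,\sigma Y],\sigma Z\rangle$, and $H^{(2)}(X,Y,Z,W)=g\big(H(X,Y,\cdot),H(Z,W,\cdot)\big)$. * For sections $a,b,v,w$ of $E$, in $\mathrm{Rm}(a,b,v,w)$ and $H^{(2)}(a,b,v,w)$ the sections are replaced by the vector fields $\pi a,\pi b,\pi v,\pi w$. * $D^0$ is the canonical generalised Levi-Civita connection with metric divergence: $D^0_uv=[u,v]_\pm$ if $u\in\Gamma(E_\mp)$, $v\in\Gamma(E_\pm)$, and $D^0_uv=\big(\nabla_XY\pm\frac16 H(X,Y,\cdot)^\sharp\big)^\pm$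 with $X=\pi u$, $Y=\pi v$ if $u,v\in\Gamma(E_\pm)$, where $\sharp$ is taken with respect to $g$. * $\mathrm{div}^{\mathcal G}(u)=\mathrm{tr}(\nabla(\pi u))$, and $\mathrm{div}=\mathrm{div}^{\mathcal G}-\langle e,\cdot\rangle$ for a given section $e\in\Gamma(E)$. * $\mathfrak{so}(E)^{\langle1\rangle}_{\mathcal G}$ is the bundle of tensors $S:(u,v)\mapsto S_uv\in E$ such that $S_u$ is skew with respect to $\langle\cdot,\cdot\rangle$ and commutes with $\tau$, and the cyclic sum of $\langle S_uv,w\rangle$ over $u,v,w$ vanishes; $(\mathrm{tr}\,S)(v)=\mathrm{tr}(u\mapsto S_uv)$. * $D=D^{\mathcal G,\mathrm{div}}=D^0+S$ is the canonical generalised Levi-Civita connection with divergence $\mathrm{div}$: here $S$ is the section of $\mathfrak{so}(E)^{\langle1\rangle}_{\mathcal G}$ that is orthogonal to $\ker\mathrm{tr}$ (for the scalar product of tensors induced by $\langle\cdot,\cdot\rangle$) and satisfies $\mathrm{div}^{\mathcal G}+\mathrm{tr}\,S=\mathrm{div}$. * $\chi_\pm^{e_\pm}(u,v)=\langle u_\pm,v_\pm\rangle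 e_\pm-\langle e_\pm,v_\pm\rangle u_\pm$ and $\chi_\pm^{e_\pm}(u,v,w)=\langle\chi_\pm^{e_\pm}(u,v),w\rangle$; $D^0_v$ acts on this trilinear form by the Leibniz rule. * The generalised Riemann tensor of $D$ is $$\mathcal Rm^D(a,b,v,w)=\tfrac12\Big\{\langle D_vD_wb-D_wD_vb-D_{[v,w]}b,\,a\rangle+\langle D_bD_av-D_aD_bv-D_{[b,a]}v,\,w\rangle+\mathrm{tr}_E\big(\langle Dv,w\rangle\langle Db,a\rangle\big)\Big\},$$ where $\mathrm{tr}_E(\langle Dv,w\rangle\langle Db,a\rangle)=\sum_i\langle D_{e_i}v,w\rangle\langle D_{e^i}b,a\rangle$ for a local frame $(e_i)$ and its dual frame, $\langle e_i,e^j\rangle=\delta_i^j$. **Theorem.** For either sign and all $a,b,v,w\in\Gamma(E_\pm)$, $$\begin{aligned} \pm\mathcal Rm^D(a,b,v,w)={}&\mathrm{Rm}(a,b,v,w)-\tfrac1{36}H^{(2)}(a,v,b,w)-\tfrac1{36}H^{(2)}(b,v,w,a)-\tfrac1{18}H^{(2)}(v,w,a,b)\\ &\pm\tfrac1{2(d-1)}\Big\{[D^0_v\chi_\pm^{e_\pm}](w,b,a)-[D^0_w\chi_\pm^{e_\pm}](v,b,a)+[D^0_b\chi_\pm^{e_\pm}](a,v,w)-[D^0_a\chi_\pm^{e_\pm}](b,v,w)\Big\}\\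 &+\tfrac1{2(d-1)^2}\Big\{2\mathcal G(e_\pm,e_\pm)\big[\mathcal G(w,a)\mathcal G(v,b)-\mathcal G(v,a)\mathcal G(w,b)\big]\\ &\qquad+\mathcal G(a,e_\pm)\big[\mathcal G(w,b)\mathcal G(v,e_\pm)-\mathcal G(v,b)\mathcal G(w,e_\pm)\big]\\ &\qquad+\mathcal G(b,e_\pm)\big[\mathcal G(v,a)\mathcal G(w,e_\pm)-\mathcal G(w,a)\mathcal G(v,e_\pm)\big]\Big\}. \end{aligned}$$ -/

import Mathlib

set_option linter.unusedSectionVars false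
open Bundle
open scoped Manifold ContDiff Topology

section aux
variable {d : ℕ} {M : Type*} [TopologicalSpace M] [ChartedSpace (EuclideanSpace ℝ (Fin d)) M]
  {F : Type*} [NormedAddCommGroup F] [NormedSpace ℝ F] [FiniteDimensional ℝ F]
  {V : M → Type*} [TopologicalSpace (TotalSpace F V)] [∀ x, AddCommGroup (V x)]
  [∀ x, Module ℝ (V x)] [∀ x, TopologicalSpace (V x)]
  [FiberBundle F V] [VectorBundle ℝ F V]
  {F₁ : Type*} [NormedAddCommGroup F₁] [NormedSpace ℝ F₁] [FiniteDimensional ℝ F₁]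
  {V₁ : M → Type*} [TopologicalSpace (TotalSpace F₁ V₁)] [∀ x, AddCommGroup (V₁ x)]
  [∀ x, Module ℝ (V₁ x)] [∀ x, TopologicalSpace (V₁ x)]
  [∀ x, IsTopologicalAddGroup (V₁ x)] [∀ x, ContinuousSMul ℝ (V₁ x)]
  [FiberBundle F₁ V₁] [VectorBundle ℝ F₁ V₁]
  {F₂ : Type*} [NormedAddCommGroup F₂] [NormedSpace ℝ F₂] [FiniteDimensional ℝ F₂]
  {V₂ : M → Type*} [TopologicalSpace (TotalSpace F₂ V₂)] [∀ x, AddCommGroup (V₂ x)]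
  [∀ x, Module ℝ (V₂ x)] [∀ x, TopologicalSpace (V₂ x)]
  [∀ x, IsTopologicalAddGroup (V₂ x)] [∀ x, ContinuousSMul ℝ (V₂ x)]
  [FiberBundle F₂ V₂] [VectorBundle ℝ F₂ V₂]

/-- A section is smooth as soon as its images under two smooth, jointly injective bundle maps are
smooth. -/
theorem contMDiff_section_of_injective
    (A₁ : Π x, V x →L[ℝ] V₁ x) (A₂ : Π x, V x →L[ℝ] V₂ x)
    (hA₁ : ContMDiff (𝓡 d) ((𝓡 d).prod 𝓘(ℝ, F →L[ℝ] F₁)) ∞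
      (fun x ↦ TotalSpace.mk' (F →L[ℝ] F₁) (E := fun x ↦ V x →L[ℝ] V₁ x) x (A₁ x)))
    (hA₂ : ContMDiff (𝓡 d) ((𝓡 d).prod 𝓘(ℝ, F →L[ℝ] F₂)) ∞
      (fun x ↦ TotalSpace.mk' (F →L[ℝ] F₂) (E := fun x ↦ V x →L[ℝ] V₂ x) x (A₂ x)))
    (hinj : ∀ x u, A₁ x u = 0 → A₂ x u = 0 → u = 0)
    (s : Π x, V x)
    (hs₁ : ContMDiff (𝓡 d) ((𝓡 d).prod 𝓘(ℝ, F₁)) ∞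
      (fun x ↦ TotalSpace.mk' F₁ (E := V₁) x (A₁ x (s x))))
    (hs₂ : ContMDiff (𝓡 d) ((𝓡 d).prod 𝓘(ℝ, F₂)) ∞
      (fun x ↦ TotalSpace.mk' F₂ (E := V₂) x (A₂ x (s x)))) :
    ContMDiff (𝓡 d) ((𝓡 d).prod 𝓘(ℝ, F)) ∞ (fun x ↦ TotalSpace.mk' F (E := V) x (s x)) := by
  intro x₀
  rw [contMDiffAt_section]
  have h₁ := ((contMDiffAt_hom_bundle _).1 (hA₁ x₀)).2
  have h₂ := ((contMDiffAt_hom_bundle _).1 (hA₂ x₀)).2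
  have k₁ := (contMDiffAt_section _).1 (hs₁ x₀)
  have k₂ := (contMDiffAt_section _).1 (hs₂ x₀)
  dsimp only at h₁ h₂ k₁ k₂
  have m := FiberBundle.mem_baseSet_trivializationAt' (F := F) (E := V) x₀
  have m₁ := FiberBundle.mem_baseSet_trivializationAt' (F := F₁) (E := V₁) x₀
  have m₂ := FiberBundle.mem_baseSet_trivializationAt' (F := F₂) (E := V₂) x₀
  set e := trivializationAt F V x₀ with he
  set e₁ := trivializationAt F₁ V₁ x₀
  set e₂ := trivializationAt F₂ V₂ x₀
  set a₁ : M → F →L[ℝ] F₁ := fun x ↦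
    ContinuousLinearMap.inCoordinates F V F₁ V₁ x₀ x x₀ x (A₁ x) with ha₁
  set a₂ : M → F →L[ℝ] F₂ := fun x ↦
    ContinuousLinearMap.inCoordinates F V F₂ V₂ x₀ x x₀ x (A₂ x) with ha₂
  have c₁ : ∀ x, x ∈ e.baseSet → x ∈ e₁.baseSet → ∀ u : V x,
      a₁ x ((e ⟨x, u⟩).2) = (e₁ ⟨x, A₁ x u⟩).2 := by
    intro x hx hx₁ u
    simp only [ha₁]
    rw [ContinuousLinearMap.inCoordinates_eq hx hx₁]
    simp [e, e₁, hx]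
  have c₂ : ∀ x, x ∈ e.baseSet → x ∈ e₂.baseSet → ∀ u : V x,
      a₂ x ((e ⟨x, u⟩).2) = (e₂ ⟨x, A₂ x u⟩).2 := by
    intro x hx hx₂ u
    simp only [ha₂]
    rw [ContinuousLinearMap.inCoordinates_eq hx hx₂]
    simp [e, e₂, hx]
  have inj0 : Function.Injective ((a₁ x₀).prod (a₂ x₀)) := by
    rw [injective_iff_map_eq_zero]
    intro y hy
    obtain ⟨u, rfl⟩ : ∃ u : V x₀, (e ⟨x₀, u⟩).2 = y :=
      ⟨(e.continuousLinearEquivAt ℝ x₀ m).symm y,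
        (e.continuousLinearEquivAt ℝ x₀ m).apply_symm_apply y⟩
    have hy₁ : a₁ x₀ ((e ⟨x₀, u⟩).2) = 0 := congrArg Prod.fst hy
    have hy₂ : a₂ x₀ ((e ⟨x₀, u⟩).2) = 0 := congrArg Prod.snd hy
    rw [c₁ x₀ m m₁] at hy₁
    rw [c₂ x₀ m m₂] at hy₂
    have z₁ : A₁ x₀ u = 0 :=
      (e₁.continuousLinearEquivAt ℝ x₀ m₁).map_eq_zero_iff.1 hy₁
    have z₂ : A₂ x₀ u = 0 :=
      (e₂.continuousLinearEquivAt ℝ x₀ m₂).map_eq_zero_iff.1 hy₂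
    rw [hinj x₀ u z₁ z₂]
    exact (e.continuousLinearEquivAt ℝ x₀ m).map_zero
  obtain ⟨L, hL⟩ := LinearMap.exists_leftInverse_of_injective
    ((a₁ x₀).prod (a₂ x₀)).toLinearMap (LinearMap.ker_eq_bot.2 inj0)
  set L' : F₁ × F₂ →L[ℝ] F := LinearMap.toContinuousLinearMap L
  set C : M → F →L[ℝ] F := fun x ↦ L' ∘L ((a₁ x).prod (a₂ x)) with hC
  have C0 : C x₀ = ((ContinuousLinearEquiv.refl ℝ F : F ≃L[ℝ] F) : F →L[ℝ] F) := by
    ext y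
    exact LinearMap.congr_fun hL y
  have Csm : ContMDiffAt (𝓡 d) 𝓘(ℝ, F →L[ℝ] F) ∞ C x₀ := by
    have : C = fun x ↦ (L' ∘L ContinuousLinearMap.inl ℝ F₁ F₂) ∘L (a₁ x) +
        (L' ∘L ContinuousLinearMap.inr ℝ F₁ F₂) ∘L (a₂ x) := by
      funext x; ext y
      simp [hC, ← map_add]
    rw [this]
    exact (contMDiffAt_const.clm_comp h₁).add (contMDiffAt_const.clm_comp h₂)
  have Ism : ContMDiffAt (𝓡 d) 𝓘(ℝ, F →L[ℝ] F) ∞ (fun x ↦ (C x).inverse) x₀ := by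
    have := (contDiffAt_map_inverse (n := ∞) (ContinuousLinearEquiv.refl ℝ F)).contMDiffAt
    rw [← C0] at this
    exact this.comp x₀ Csm
  have Ssm : ContMDiffAt (𝓡 d) 𝓘(ℝ, F) ∞
      (fun x ↦ (C x).inverse (L' ((e₁ ⟨x, A₁ x (s x)⟩).2, (e₂ ⟨x, A₂ x (s x)⟩).2))) x₀ :=
    Ism.clm_apply (contMDiffAt_const.clm_apply (k₁.prodMk_space k₂))
  refine Ssm.congr_of_eventuallyEq ?_
  have inv_ev : ∀ᶠ x in 𝓝 x₀, C x ∈ Set.range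
      ((↑) : (F ≃L[ℝ] F) → F →L[ℝ] F) := by
    apply Csm.continuousAt
    rw [C0]
    exact ContinuousLinearEquiv.nhds _
  filter_upwards [inv_ev, e.open_baseSet.mem_nhds m, e₁.open_baseSet.mem_nhds m₁,
    e₂.open_baseSet.mem_nhds m₂] with x hx hxe hx₁ hx₂
  obtain ⟨φ, hφ⟩ := hx
  rw [← c₁ x hxe hx₁, ← c₂ x hxe hx₂]
  have : L' (a₁ x (e ⟨x, s x⟩).2, a₂ x (e ⟨x, s x⟩).2) = C x ((e ⟨x, s x⟩).2) := rfl
  rw [this, ← hφ, ContinuousLinearMap.inverse_equiv]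
  simp

variable [T2Space M] [IsManifold (𝓡 d) ∞ M] [ContMDiffVectorBundle ∞ F V (𝓡 d)]

theorem exists_section_eq (x : M) (u : V x) :
    ∃ s : Cₛ^∞⟮𝓡 d; F, V⟯, s x = u := by
  obtain ⟨t, ht, hts⟩ := FiberBundle.exists_contMDiffOn_extend (k := ∞) (𝓡 d) F u
  obtain ⟨t', ht't, ht'o, hxt'⟩ := mem_nhds_iff.1 ht
  obtain ⟨f, -, hf⟩ := (SmoothBumpFunction.nhds_basis_tsupport (I := 𝓡 d) x).mem_iff.1
    (ht'o.mem_nhds hxt')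
  refine ⟨⟨(f : M → ℝ) • FiberBundle.extend F u, ?_⟩, ?_⟩
  · exact ContMDiffOn.smul_section_of_tsupport f.contMDiff.contMDiffOn ht'o hf (hts.mono ht't)
  · simp
end aux


namespace GenGeom

/-- Smooth sections of the vector bundle `V → M` with typical fibre `F`. -/
abbrev Sec (d : ℕ) {M : Type*} [TopologicalSpace M] [ChartedSpace (EuclideanSpace ℝ (Fin d)) M]
    (F : Type*) [NormedAddCommGroup F] [NormedSpace ℝ F] (V : M → Type*)
    [TopologicalSpace (TotalSpace F V)] [∀ x, TopologicalSpace (V x)] [FiberBundle F V] :=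
  Cₛ^∞⟮𝓡 d; F, V⟯

/-- Smooth vector fields on the `d`-dimensional manifold `M`. -/
abbrev VField (d : ℕ) (M : Type*) [TopologicalSpace M]
    [ChartedSpace (EuclideanSpace ℝ (Fin d)) M] [IsManifold (𝓡 d) ∞ M] :=
  Cₛ^∞⟮𝓡 d; EuclideanSpace ℝ (Fin d), (TangentSpace (𝓡 d) : M → Type _)⟯

section general

variable {d : ℕ} {M : Type*} [TopologicalSpace M] [ChartedSpace (EuclideanSpace ℝ (Fin d)) M]
  {F : Type*} [NormedAddCommGroup F] [NormedSpace ℝ F]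
  {V : M → Type*} [TopologicalSpace (TotalSpace F V)] [∀ x, AddCommGroup (V x)]
  [∀ x, Module ℝ (V x)] [∀ x, TopologicalSpace (V x)]
  [FiberBundle F V] [VectorBundle ℝ F V]
  {F₁ : Type*} [NormedAddCommGroup F₁] [NormedSpace ℝ F₁]
  {V₁ : M → Type*} [TopologicalSpace (TotalSpace F₁ V₁)] [∀ x, AddCommGroup (V₁ x)]
  [∀ x, Module ℝ (V₁ x)] [∀ x, TopologicalSpace (V₁ x)]
  [∀ x, IsTopologicalAddGroup (V₁ x)] [∀ x, ContinuousSMul ℝ (V₁ x)]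
  [FiberBundle F₁ V₁] [VectorBundle ℝ F₁ V₁]

/-- The product `f s` of a smooth function and a smooth section. -/
noncomputable def fsmul (f : C^∞⟮𝓡 d, M; ℝ⟯) (s : Sec d F V) : Sec d F V :=
  ⟨(f : M → ℝ) • ⇑s, f.contMDiff.smul_section s.contMDiff⟩

/-- The differential `X(f) = df_x(X)` of a function `f` at `x` along a tangent vector `X`. -/
noncomputable def dirDeriv (f : M → ℝ) (x : M) (X : TangentSpace (𝓡 d) x) : ℝ :=
  mvfderiv (𝓡 d) f x X

/-- A smooth section of `Hom(V, V₁)`. -/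
def SmoothHom (d : ℕ) [ChartedSpace (EuclideanSpace ℝ (Fin d)) M]
    (F F₁ : Type*) [NormedAddCommGroup F] [NormedSpace ℝ F] [NormedAddCommGroup F₁]
    [NormedSpace ℝ F₁] [TopologicalSpace (TotalSpace F V)] [TopologicalSpace (TotalSpace F₁ V₁)]
    [FiberBundle F V] [VectorBundle ℝ F V] [FiberBundle F₁ V₁] [VectorBundle ℝ F₁ V₁]
    (A : Π x, V x →L[ℝ] V₁ x) : Prop :=
  ContMDiff (𝓡 d) ((𝓡 d).prod 𝓘(ℝ, F →L[ℝ] F₁)) ∞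
    (fun x ↦ TotalSpace.mk' (F →L[ℝ] F₁) (E := fun x ↦ V x →L[ℝ] V₁ x) x (A x))

/-- The action of a smooth bundle map on smooth sections. -/
noncomputable def mapSec (A : Π x, V x →L[ℝ] V₁ x) (hA : SmoothHom d F F₁ A) (s : Sec d F V) : Sec d F₁ V₁ :=
  ⟨fun x ↦ A x (s x), ContMDiff.clm_bundle_apply hA s.contMDiff⟩

/-- A smooth section through a prescribed vector. -/
noncomputable def extendSec [T2Space M] [FiniteDimensional ℝ F] [IsManifold (𝓡 d) ∞ M] [ContMDiffVectorBundle ∞ F V (𝓡 d)]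
    (x : M) (u : V x) : Sec d F V :=
  (exists_section_eq x u).choose

theorem extendSec_apply [T2Space M] [FiniteDimensional ℝ F] [IsManifold (𝓡 d) ∞ M] [ContMDiffVectorBundle ∞ F V (𝓡 d)]
    (x : M) (u : V x) : (extendSec x u : Sec d F V) x = u :=
  (exists_section_eq x u).choose_spec

end general

/-- A Courant algebroid structure on the vector bundle `V → M`: a fibrewise nondegenerate symmetric
pairing `⟨·,·⟩`, an anchor `π : V → TM` and a (Dorfman) bracket on smooth sections. -/
structure CourantAlgebroid (d : ℕ) {M : Type*} [TopologicalSpace M]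
    [ChartedSpace (EuclideanSpace ℝ (Fin d)) M] [IsManifold (𝓡 d) ∞ M]
    (F : Type*) [NormedAddCommGroup F] [NormedSpace ℝ F]
    (V : M → Type*) [TopologicalSpace (TotalSpace F V)] [∀ x, AddCommGroup (V x)]
    [∀ x, Module ℝ (V x)] [∀ x, TopologicalSpace (V x)]
    [FiberBundle F V] [VectorBundle ℝ F V] where
  pairing : Π x, V x →L[ℝ] V x →L[ℝ] ℝ
  pairing_smooth : ContMDiff (𝓡 d) ((𝓡 d).prod 𝓘(ℝ, F →L[ℝ] F →L[ℝ] ℝ)) ∞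
    (fun x ↦ TotalSpace.mk' (F →L[ℝ] F →L[ℝ] ℝ) (E := fun x ↦ V x →L[ℝ] V x →L[ℝ] ℝ) x
      (pairing x))
  pairing_symm : ∀ x u v, pairing x u v = pairing x v u
  pairing_nondeg : ∀ x u, (∀ v, pairing x u v = 0) → u = 0
  anchor : Π x, V x →L[ℝ] TangentSpace (𝓡 d) x
  anchor_smooth : SmoothHom d F (EuclideanSpace ℝ (Fin d)) anchor
  bracket : Sec d F V →ₗ[ℝ] Sec d F V →ₗ[ℝ] Sec d F V
  /-- `[u,[v,w]] = [[u,v],w] + [v,[u,w]]` -/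
  jacobi : ∀ u v w, bracket u (bracket v w) = bracket (bracket u v) w + bracket v (bracket u w)
  /-- `π[u,v] = [πu,πv]` -/
  anchor_bracket : ∀ (u v : Sec d F V) (x : M), anchor x (bracket u v x) =
    VectorField.mlieBracket (𝓡 d) (fun y ↦ anchor y (u y)) (fun y ↦ anchor y (v y)) x
  /-- `[u,fv] = f[u,v] + π(u)(f)v` -/
  leibniz : ∀ (u v : Sec d F V) (f : C^∞⟮𝓡 d, M; ℝ⟯) (x : M),
    bracket u (fsmul f v) x = f x • bracket u v x + dirDeriv f x (anchor x (u x)) • v x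
  /-- `π(u)⟨v,w⟩ = ⟨[u,v],w⟩ + ⟨v,[u,w]⟩` -/
  deriv_pairing : ∀ (u v w : Sec d F V) (x : M),
    dirDeriv (fun y ↦ pairing y (v y) (w y)) x (anchor x (u x)) =
      pairing x (bracket u v x) (w x) + pairing x (v x) (bracket u w x)
  /-- `⟨[u,u],v⟩ = ½ π(v)⟨u,u⟩` -/
  pairing_bracket_self : ∀ (u v : Sec d F V) (x : M),
    pairing x (bracket u u x) (v x) =
      (1 / 2) * dirDeriv (fun y ↦ pairing y (u y) (u y)) x (anchor x (v x))

/-- An exact Courant algebroid: the sequence `0 → T*M → V → TM → 0` given by the anchor `π` and its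
transpose with respect to the pairing is exact. (`π*` is injective as `π` is surjective, and
its image consists of the `u` such that `⟨u,·⟩` factors through `π`.) -/
structure ExactCourantAlgebroid (d : ℕ) {M : Type*} [TopologicalSpace M]
    [ChartedSpace (EuclideanSpace ℝ (Fin d)) M] [IsManifold (𝓡 d) ∞ M]
    (F : Type*) [NormedAddCommGroup F] [NormedSpace ℝ F]
    (V : M → Type*) [TopologicalSpace (TotalSpace F V)] [∀ x, AddCommGroup (V x)]
    [∀ x, Module ℝ (V x)] [∀ x, TopologicalSpace (V x)]
    [FiberBundle F V] [VectorBundle ℝ F V] extends CourantAlgebroid d F V where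
  anchor_surjective : ∀ x, Function.Surjective (anchor x)
  anchor_eq_zero_iff : ∀ x u, anchor x u = 0 ↔
    ∃ ξ : TangentSpace (𝓡 d) x →ₗ[ℝ] ℝ, ∀ v, pairing x u v = ξ (anchor x v)

section main

variable {d : ℕ} {M : Type*} [TopologicalSpace M] [ChartedSpace (EuclideanSpace ℝ (Fin d)) M]
  [IsManifold (𝓡 d) ∞ M]
  {F : Type*} [NormedAddCommGroup F] [NormedSpace ℝ F]
  {V : M → Type*} [TopologicalSpace (TotalSpace F V)] [∀ x, AddCommGroup (V x)]
  [∀ x, Module ℝ (V x)] [∀ x, TopologicalSpace (V x)]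
  [∀ x, IsTopologicalAddGroup (V x)] [∀ x, ContinuousSMul ℝ (V x)]
  [FiberBundle F V] [VectorBundle ℝ F V]

/-- A semi-Riemannian generalised metric on an exact Courant algebroid, given by its endomorphism
`τ`, so that the metric is the bilinear form `𝒢(u,v) = ⟨τu,v⟩`: it is symmetric, `τ` is an
involution, and `𝒢` is nondegenerate on `T*M = ker π`. -/
structure GeneralisedMetric (A : ExactCourantAlgebroid d F V) where
  endo : Π x, V x →L[ℝ] V x
  endo_smooth : SmoothHom d F F endo
  endo_symm : ∀ x u v, A.pairing x (endo x u) v = A.pairing x (endo x v) u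
  endo_endo : ∀ x u, endo x (endo x u) = u
  nondeg_ker : ∀ x u, A.anchor x u = 0 →
    (∀ v, A.anchor x v = 0 → A.pairing x (endo x u) v = 0) → u = 0

namespace GeneralisedMetric

variable {A : ExactCourantAlgebroid d F V} (G : GeneralisedMetric A)

/-- The generalised metric as a bilinear form, `𝒢(u,v) = ⟨τu,v⟩`. -/
noncomputable def form (x : M) (u v : V x) : ℝ := A.pairing x (G.endo x u) v

/-- The real number `±1` attached to a sign. -/
noncomputable def sgn (ε : ℤˣ) : ℝ := ((ε : ℤ) : ℝ)

theorem sgn_mul_self (ε : ℤˣ) : sgn ε * sgn ε = 1 := by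
  rcases Int.units_eq_one_or ε with rfl | rfl <;> simp [sgn]

theorem sgn_neg (ε : ℤˣ) : sgn (-ε) = -sgn ε := by simp [sgn]

/-- The fibre at `x` of `E_±`, the `±1`-eigenbundle of `τ`. -/
def eigen (ε : ℤˣ) (x : M) : Submodule ℝ (V x) where
  carrier := {u | G.endo x u = sgn ε • u}
  add_mem' := by
    intro u v hu hv
    simp only [Set.mem_ofPred_eq] at *
    rw [map_add, hu, hv, smul_add]
  zero_mem' := by simp
  smul_mem' := by
    intro c u hu
    simp only [Set.mem_ofPred_eq] at *
    rw [map_smul, hu, smul_comm]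

theorem mem_eigen {ε : ℤˣ} {x : M} {u : V x} : u ∈ G.eigen ε x ↔ G.endo x u = sgn ε • u := Iff.rfl

/-- `T*M = ker π` is isotropic. -/
theorem pairing_ker {x : M} {u v : V x} (hu : A.anchor x u = 0) (hv : A.anchor x v = 0) :
    A.pairing x u v = 0 := by
  obtain ⟨ξ, hξ⟩ := (A.anchor_eq_zero_iff x u).1 hu
  rw [hξ, hv, map_zero]

/-- `T*M = ker π` contains its orthogonal complement. -/
theorem anchor_eq_zero_of_orthogonal {x : M} {u : V x}
    (h : ∀ v, A.anchor x v = 0 → A.pairing x u v = 0) : A.anchor x u = 0 := by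
  rw [A.anchor_eq_zero_iff]
  have hs := A.anchor_surjective x
  obtain ⟨ι, hι⟩ := (A.anchor x).toLinearMap.exists_rightInverse_of_surjective
    (LinearMap.range_eq_top.2 hs)
  refine ⟨(A.pairing x u).toLinearMap ∘ₗ ι, fun v ↦ ?_⟩
  have h1 : A.anchor x (v - ι (A.anchor x v)) = 0 := by
    have := LinearMap.congr_fun hι (A.anchor x v)
    simp only [LinearMap.comp_apply, LinearMap.id_apply, ContinuousLinearMap.coe_coe] at this
    rw [map_sub, this, sub_self]
  have h2 := h _ h1
  rw [map_sub, sub_eq_zero] at h2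
  exact h2

theorem eq_zero_of_mem_eigen {ε : ℤˣ} {x : M} {u : V x} (hu : u ∈ G.eigen ε x)
    (h : A.anchor x u = 0) : u = 0 := by
  refine G.nondeg_ker x u h fun v hv ↦ ?_
  rw [G.mem_eigen.1 hu, map_smul, smul_apply, pairing_ker h hv, smul_zero]

theorem exists_mem_eigen [FiniteDimensional ℝ F] (ε : ℤˣ) (x : M) (X : TangentSpace (𝓡 d) x) :
    ∃ u ∈ G.eigen ε x, A.anchor x u = X := by
  have : FiniteDimensional ℝ (V x) := VectorBundle.finiteDimensional ℝ F V x
  obtain ⟨u, hu⟩ := A.anchor_surjective x X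
  let K : Submodule ℝ (V x) := LinearMap.ker (A.anchor x).toLinearMap
  let B : K →ₗ[ℝ] Module.Dual ℝ K := LinearMap.mk₂ ℝ
    (fun k l ↦ A.pairing x (G.endo x k) l) (by simp) (by simp) (by simp) (by simp)
  have hB : Function.Injective B := by
    rw [injective_iff_map_eq_zero]
    intro k hk
    exact Subtype.ext (G.nondeg_ker x k k.2 fun v hv ↦ LinearMap.congr_fun hk ⟨v, hv⟩)
  have hB' : Function.Surjective B :=
    (LinearMap.injective_iff_surjective_of_finrank_eq_finrank
      (Subspace.dual_finrank_eq (K := ℝ) (V := K)).symm).1 hB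
  obtain ⟨k, hk⟩ := hB' (((A.pairing x (sgn ε • u - G.endo x u)).toLinearMap).domRestrict K)
  have hk0 : A.anchor x (k : V x) = 0 := k.2
  refine ⟨u + k, ?_, by rw [map_add, hu, hk0, add_zero]⟩
  have hz : G.endo x (u + k) - sgn ε • (u + (k : V x)) = 0 := by
    apply G.eq_zero_of_mem_eigen (ε := -ε)
    · rw [mem_eigen, map_sub, map_smul, G.endo_endo, sgn_neg, smul_sub, smul_smul]
      have := sgn_mul_self ε
      rw [neg_mul, this]
      module
    · apply anchor_eq_zero_of_orthogonal
      intro v hv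
      have h1 := LinearMap.congr_fun hk ⟨v, hv⟩
      have h2 : A.pairing x (G.endo x k) v = A.pairing x (sgn ε • u - G.endo x u) v := h1
      have h3 := pairing_ker (A := A) hk0 hv
      simp only [map_sub, map_add, map_smul, sub_apply,
        add_apply, smul_apply, smul_add] at h2 ⊢
      rw [h2, h3]
      simp
  exact sub_eq_zero.1 hz

/-- The anchor restricts to an isomorphism `E_± ≅ TM`. -/
noncomputable def anchorEquiv [FiniteDimensional ℝ F] (ε : ℤˣ) (x : M) :
    G.eigen ε x ≃ₗ[ℝ] TangentSpace (𝓡 d) x :=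
  LinearEquiv.ofBijective ((A.anchor x).toLinearMap.domRestrict (G.eigen ε x)) <| by
    constructor
    · rw [injective_iff_map_eq_zero]
      intro u hu
      exact Subtype.ext (G.eq_zero_of_mem_eigen u.2 hu)
    · intro X
      obtain ⟨u, hu, rfl⟩ := G.exists_mem_eigen ε x X
      exact ⟨⟨u, hu⟩, rfl⟩

/-- The lift `TM → E_± ⊆ V`, inverse to the anchor. -/
noncomputable def lift [FiniteDimensional ℝ F] (ε : ℤˣ) (x : M) :
    TangentSpace (𝓡 d) x →ₗ[ℝ] V x :=
  (G.eigen ε x).subtype ∘ₗ (G.anchorEquiv ε x).symm.toLinearMap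

section lift
variable [FiniteDimensional ℝ F]

theorem endo_lift (ε : ℤˣ) (x : M) (X : TangentSpace (𝓡 d) x) :
    G.endo x (G.lift ε x X) = sgn ε • G.lift ε x X :=
  ((G.anchorEquiv ε x).symm X).2

theorem anchor_lift (ε : ℤˣ) (x : M) (X : TangentSpace (𝓡 d) x) :
    A.anchor x (G.lift ε x X) = X :=
  (G.anchorEquiv ε x).apply_symm_apply X

theorem lift_anchor {ε : ℤˣ} {x : M} {u : V x} (hu : G.endo x u = sgn ε • u) :
    G.lift ε x (A.anchor x u) = u :=
  congrArg Subtype.val ((G.anchorEquiv ε x).symm_apply_apply ⟨u, hu⟩)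

/-- The semi-Riemannian metric on `M` induced by `𝒢`: the restriction of `𝒢`, equivalently of
`⟨·,·⟩`, to `E_+ ≅ TM`. -/
noncomputable def metric (x : M) (X Y : TangentSpace (𝓡 d) x) : ℝ :=
  A.pairing x (G.lift 1 x X) (G.lift 1 x Y)

theorem pairing_eigen_neg {ε : ℤˣ} {x : M} {u v : V x} (hu : G.endo x u = sgn ε • u)
    (hv : G.endo x v = sgn (-ε) • v) : A.pairing x u v = 0 := by
  have h := G.endo_symm x u v
  rw [hu, hv, sgn_neg, A.pairing_symm x _ u] at h
  simp only [map_smul, smul_apply, neg_smul, map_neg, smul_eq_mul] at h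
  have h2 := sgn_mul_self ε
  have h3 : sgn ε * A.pairing x u v = 0 := by linarith
  linear_combination sgn ε * h3 - A.pairing x u v * h2

theorem pairing_lift_lift (ε : ℤˣ) (x : M) (X Y : TangentSpace (𝓡 d) x) :
    A.pairing x (G.lift ε x X) (G.lift ε x Y) = sgn ε * G.metric x X Y := by
  have key : A.pairing x (G.lift 1 x X) (G.lift 1 x Y) +
      A.pairing x (G.lift (-1) x X) (G.lift (-1) x Y) = 0 := by
    have h := pairing_ker (A := A) (x := x) (u := G.lift 1 x X - G.lift (-1) x X)
      (v := G.lift 1 x Y - G.lift (-1) x Y) (by simp [anchor_lift]) (by simp [anchor_lift])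
    have h1 := G.pairing_eigen_neg (G.endo_lift 1 x X) (G.endo_lift (-1) x Y)
    have h2 := G.pairing_eigen_neg (G.endo_lift 1 x Y) (G.endo_lift (-1) x X)
    rw [A.pairing_symm] at h2
    simp only [map_sub, sub_apply] at h
    linarith
  rcases Int.units_eq_one_or ε with rfl | rfl
  · simp [sgn, metric]
  · simp only [metric, sgn_neg]
    simp only [sgn, Units.val_one, Int.cast_one]
    linarith

end lift

/-- The projection `P_± = ½(1 ± τ)` of the fibre onto `E_±` along `E_∓`. -/
noncomputable def projAt (ε : ℤˣ) (x : M) : V x →ₗ[ℝ] V x :=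
  (1 / 2 : ℝ) • (LinearMap.id + sgn ε • (G.endo x).toLinearMap)

/-- The projection `P_± = ½(1 ± τ)` onto `E_±` along `E_∓`, on smooth sections. -/
noncomputable def proj (ε : ℤˣ) (u : Sec d F V) : Sec d F V :=
  (1 / 2 : ℝ) • (u + sgn ε • mapSec G.endo G.endo_smooth u)

theorem proj_apply (ε : ℤˣ) (u : Sec d F V) (x : M) :
    G.proj ε u x = (1 / 2 : ℝ) • (u x + sgn ε • G.endo x (u x)) := rfl

theorem proj_eq_projAt (ε : ℤˣ) (u : Sec d F V) (x : M) :
    G.proj ε u x = G.projAt ε x (u x) := rfl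

theorem endo_proj (ε : ℤˣ) (u : Sec d F V) (x : M) :
    G.endo x (G.proj ε u x) = sgn ε • G.proj ε u x := by
  have : G.proj ε u x = (1 / 2 : ℝ) • (u x + sgn ε • G.endo x (u x)) := rfl
  rw [this]
  simp only [map_smul, map_add, G.endo_endo, smul_add, smul_smul]
  have h := sgn_mul_self ε
  rw [show sgn ε * (1 / 2 * sgn ε) = 1 / 2 by linear_combination (1 / 2) * h,
    mul_comm (sgn ε) (1 / 2)]
  abel

theorem proj_add_proj_neg (ε : ℤˣ) (u : Sec d F V) : G.proj ε u + G.proj (-ε) u = u := by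
  simp only [proj, sgn_neg]
  module

/-- The vector field `πu` underlying a section `u`. -/
noncomputable def anch (_G : GeneralisedMetric A) (u : Sec d F V) : VField d M :=
  mapSec A.anchor A.anchor_smooth u

section smooth
variable [FiniteDimensional ℝ F]

/-- The smooth section of `E_±` lifting a smooth vector field. -/
noncomputable def liftSec (ε : ℤˣ) (X : VField d M) : Sec d F V where
  toFun x := G.lift ε x (X x)
  contMDiff_toFun := by
    have h0 : SmoothHom d F F (fun x ↦ G.endo x - sgn ε • ContinuousLinearMap.id ℝ (V x)) := by
      have hid : SmoothHom d F F (fun x ↦ ContinuousLinearMap.id ℝ (V x)) := by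
        intro x₀
        rw [contMDiffAt_hom_bundle]
        refine ⟨contMDiffAt_id, ?_⟩
        refine (contMDiffAt_const (c := ContinuousLinearMap.id ℝ F)).congr_of_eventuallyEq ?_
        filter_upwards [(trivializationAt F V x₀).open_baseSet.mem_nhds
          (FiberBundle.mem_baseSet_trivializationAt' x₀)] with x hx
        ext y
        rw [ContinuousLinearMap.inCoordinates_eq hx hx]
        simp
      exact ContMDiff.sub_section G.endo_smooth (ContMDiff.const_smul_section (a := sgn ε) hid)
    refine contMDiff_section_of_injective A.anchor _ A.anchor_smooth h0 ?_ _ ?_ ?_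
    · intro x u h1 h2
      refine G.eq_zero_of_mem_eigen (ε := ε) ?_ h1
      rw [mem_eigen]
      simpa [sub_eq_zero] using h2
    · simpa only [anchor_lift] using X.contMDiff
    · have : ∀ x, (G.endo x - sgn ε • ContinuousLinearMap.id ℝ (V x)) (G.lift ε x (X x)) = 0 := by
        intro x; simp [endo_lift]
      simp only [this]
      exact contMDiff_zeroSection ℝ V
end smooth


section leviCivita
variable [FiniteDimensional ℝ F] [T2Space M] [ContMDiffVectorBundle ∞ F V (𝓡 d)]

theorem liftSec_apply (ε : ℤˣ) (X : VField d M) (x : M) : G.liftSec ε X x = G.lift ε x (X x) := rfl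

theorem anch_apply (u : Sec d F V) (x : M) : G.anch u x = A.anchor x (u x) := rfl

theorem mdifferentiableAt_pairing (u v : Sec d F V) (x : M) :
    MDifferentiableAt (𝓡 d) 𝓘(ℝ) (fun y ↦ A.pairing y (u y) (v y)) x := by
  have h : ContMDiff (𝓡 d) ((𝓡 d).prod 𝓘(ℝ)) ∞
      (fun y ↦ TotalSpace.mk' ℝ (E := Bundle.Trivial M ℝ) y (A.pairing y (u y) (v y))) := by
    apply ContMDiff.clm_bundle_apply₂ (F₁ := F) (F₂ := F)
    · exact A.pairing_smooth
    · exact u.contMDiff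
    · exact v.contMDiff
  have h2 := h x
  simp only [contMDiffAt_totalSpace] at h2
  exact h2.2.mdifferentiableAt (by simp)

/-- Pointwise orthogonal sections have skew-symmetric bracket. -/
theorem bracket_swap {u v : Sec d F V} (h : ∀ x, A.pairing x (u x) (v x) = 0) :
    A.bracket u v = -A.bracket v u := by
  ext x
  rw [← sub_eq_zero]
  apply A.pairing_nondeg x
  intro w
  have h1 := A.pairing_bracket_self (u + v) (extendSec x w) x
  have h2 := A.pairing_bracket_self u (extendSec x w) x
  have h3 := A.pairing_bracket_self v (extendSec x w) x
  rw [extendSec_apply] at h1 h2 h3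
  have hf : (fun y ↦ A.pairing y ((u + v) y) ((u + v) y)) =
      fun y ↦ A.pairing y (u y) (u y) + A.pairing y (v y) (v y) := by
    funext y
    have := A.pairing_symm y (v y) (u y)
    simp only [ContMDiffSection.coe_add, Pi.add_apply, map_add, add_apply, this, h]
    ring
  rw [hf] at h1
  have hd : dirDeriv (fun y ↦ A.pairing y (u y) (u y) + A.pairing y (v y) (v y)) x
      (A.anchor x w) = dirDeriv (fun y ↦ A.pairing y (u y) (u y)) x (A.anchor x w) +
        dirDeriv (fun y ↦ A.pairing y (v y) (v y)) x (A.anchor x w) := by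
    simp only [dirDeriv]
    rw [mvfderiv_fun_add (mdifferentiableAt_pairing u u x) (mdifferentiableAt_pairing v v x)]
    rfl
  rw [hd] at h1
  simp only [map_add, LinearMap.add_apply, ContMDiffSection.coe_add, Pi.add_apply,
    add_apply] at h1
  simp only [ContMDiffSection.coe_neg, Pi.neg_apply, sub_neg_eq_add, map_add, add_apply]
  linarith

theorem pairing_liftSec_neg (ε : ℤˣ) (X Y : VField d M) (x : M) :
    A.pairing x (G.liftSec (-ε) X x) (G.liftSec ε Y x) = 0 := by
  rw [A.pairing_symm]
  exact G.pairing_eigen_neg (G.endo_lift ε x _) (G.endo_lift (-ε) x _)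

theorem bracket_lift_swap (ε : ℤˣ) (X Y : VField d M) :
    A.bracket (G.liftSec (-ε) X) (G.liftSec ε Y) =
      -A.bracket (G.liftSec ε Y) (G.liftSec (-ε) X) :=
  bracket_swap (G.pairing_liftSec_neg ε X Y)

/-- The connections `∇^±` on `TM`, `∇^±_X Y = π([X^∓, Y^±]_±)`. -/
noncomputable def nablaPM (ε : ℤˣ) (X Y : VField d M) : VField d M :=
  G.anch (G.proj ε (A.bracket (G.liftSec (-ε) X) (G.liftSec ε Y)))

/-- The Levi-Civita connection of the induced metric, as the mean of `∇^+` and `∇^-`; that it is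
torsion-free and metric is `isLeviCivita_leviCivita`. -/
noncomputable def leviCivita (X Y : VField d M) : VField d M :=
  (1 / 2 : ℝ) • (G.nablaPM 1 X Y + G.nablaPM (-1) X Y)

/-- A connection on `TM` is the Levi-Civita connection of `g` if it is torsion-free and `g` is
parallel. -/
structure IsLeviCivita (g : Π x : M, TangentSpace (𝓡 d) x → TangentSpace (𝓡 d) x → ℝ)
    (nabla : VField d M → VField d M → VField d M) : Prop where
  add_left : ∀ X X' Y, nabla (X + X') Y = nabla X Y + nabla X' Y
  fsmul_left : ∀ (f : C^∞⟮𝓡 d, M; ℝ⟯) X Y, nabla (fsmul f X) Y = fsmul f (nabla X Y)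
  add_right : ∀ X Y Y', nabla X (Y + Y') = nabla X Y + nabla X Y'
  leibniz : ∀ (f : C^∞⟮𝓡 d, M; ℝ⟯) X Y x,
    nabla X (fsmul f Y) x = f x • nabla X Y x + dirDeriv f x (X x) • Y x
  torsion_free : ∀ X Y x, nabla X Y x - nabla Y X x = VectorField.mlieBracket (𝓡 d) X Y x
  metric : ∀ X Y Z x, dirDeriv (fun y ↦ g y (Y y) (Z y)) x (X x) =
    g x (nabla X Y x) (Z x) + g x (Y x) (nabla X Z x)

theorem nablaPM_apply (ε : ℤˣ) (X Y : VField d M) (x : M) : G.nablaPM ε X Y x =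
    A.anchor x ((1 / 2 : ℝ) • (A.bracket (G.liftSec (-ε) X) (G.liftSec ε Y) x +
      sgn ε • G.endo x (A.bracket (G.liftSec (-ε) X) (G.liftSec ε Y) x))) := rfl

theorem leviCivita_apply (X Y : VField d M) (x : M) : G.leviCivita X Y x =
    (1 / 2 : ℝ) • (G.nablaPM 1 X Y x + G.nablaPM (-1) X Y x) := rfl

theorem liftSec_add (ε : ℤˣ) (X Y : VField d M) :
    G.liftSec ε (X + Y) = G.liftSec ε X + G.liftSec ε Y := by
  ext x; simp [liftSec_apply]

theorem fsmul_apply (f : C^∞⟮𝓡 d, M; ℝ⟯) (u : Sec d F V) (x : M) :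
    fsmul f u x = f x • u x := rfl

theorem fsmul_vfield_apply (f : C^∞⟮𝓡 d, M; ℝ⟯) (X : VField d M) (x : M) :
    fsmul f X x = f x • X x := rfl

theorem liftSec_fsmul (ε : ℤˣ) (f : C^∞⟮𝓡 d, M; ℝ⟯) (X : VField d M) :
    G.liftSec ε (fsmul f X) = fsmul f (G.liftSec ε X) := by
  ext x; simp [liftSec_apply, fsmul_apply]

theorem anchor_liftSec (ε : ℤˣ) (X : VField d M) (x : M) :
    A.anchor x (G.liftSec ε X x) = X x := G.anchor_lift ε x (X x)

theorem endo_liftSec (ε : ℤˣ) (X : VField d M) (x : M) :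
    G.endo x (G.liftSec ε X x) = sgn ε • G.liftSec ε X x := G.endo_lift ε x (X x)

theorem pairing_proj_lift (ε : ℤˣ) (u : Sec d F V) (x : M) (Z : TangentSpace (𝓡 d) x) :
    A.pairing x (u x) (G.lift ε x Z) =
      sgn ε * G.metric x (A.anchor x (G.proj ε u x)) Z := by
  have h1 : u x = G.proj ε u x + G.proj (-ε) u x :=
    congrArg (fun s : Sec d F V ↦ s x) (G.proj_add_proj_neg ε u).symm
  rw [h1, map_add, add_apply]
  have h2 : A.pairing x (G.proj (-ε) u x) (G.lift ε x Z) = 0 := by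
    rw [A.pairing_symm]
    exact G.pairing_eigen_neg (G.endo_lift ε x Z) (G.endo_proj (-ε) u x)
  rw [h2, add_zero, ← G.pairing_lift_lift, G.lift_anchor (G.endo_proj ε u x)]

theorem metric_nablaPM (ε : ℤˣ) (X Y Z : VField d M) (x : M) :
    A.pairing x (A.bracket (G.liftSec (-ε) X) (G.liftSec ε Y) x) (G.liftSec ε Z x) =
      sgn ε * G.metric x (G.nablaPM ε X Y x) (Z x) :=
  G.pairing_proj_lift ε _ x (Z x)

theorem metric_symm (x : M) (X Y : TangentSpace (𝓡 d) x) : G.metric x X Y = G.metric x Y X :=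
  A.pairing_symm x _ _

theorem nablaPM_metric (ε : ℤˣ) (X Y Z : VField d M) (x : M) :
    dirDeriv (fun y ↦ G.metric y (Y y) (Z y)) x (X x) =
      G.metric x (G.nablaPM ε X Y x) (Z x) + G.metric x (Y x) (G.nablaPM ε X Z x) := by
  have h := A.deriv_pairing (G.liftSec (-ε) X) (G.liftSec ε Y) (G.liftSec ε Z) x
  rw [anchor_liftSec, metric_nablaPM, A.pairing_symm x (G.liftSec ε Y x), metric_nablaPM,
    G.metric_symm x _ (Y x)] at h
  have hf : (fun y ↦ A.pairing y (G.liftSec ε Y y) (G.liftSec ε Z y)) =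
      fun y ↦ sgn ε * G.metric y (Y y) (Z y) := by
    funext y; exact G.pairing_lift_lift ε y _ _
  rw [hf] at h
  rcases Int.units_eq_one_or ε with rfl | rfl
  · simpa [sgn] using h
  · simp only [dirDeriv, sgn, Units.val_neg, Units.val_one, Int.reduceNeg, Int.cast_neg,
      Int.cast_one, neg_mul, one_mul] at h ⊢
    rw [mvfderiv_fun_neg] at h
    simp only [neg_apply] at h
    linarith

theorem metric_add_left (x : M) (X Y Z : TangentSpace (𝓡 d) x) :
    G.metric x (X + Y) Z = G.metric x X Z + G.metric x Y Z := by simp [metric]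

theorem metric_smul_left (x : M) (c : ℝ) (X Z : TangentSpace (𝓡 d) x) :
    G.metric x (c • X) Z = c * G.metric x X Z := by simp [metric]

theorem nablaPM_add_left (ε : ℤˣ) (X X' Y : VField d M) :
    G.nablaPM ε (X + X') Y = G.nablaPM ε X Y + G.nablaPM ε X' Y := by
  ext1 x
  simp only [ContMDiffSection.coe_add, Pi.add_apply, nablaPM_apply, liftSec_add, map_add,
    LinearMap.add_apply, map_smul]
  module

theorem nablaPM_add_right (ε : ℤˣ) (X Y Y' : VField d M) :
    G.nablaPM ε X (Y + Y') = G.nablaPM ε X Y + G.nablaPM ε X Y' := by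
  ext1 x
  simp only [ContMDiffSection.coe_add, Pi.add_apply, nablaPM_apply, liftSec_add, map_add,
    map_smul]
  module

theorem nablaPM_leibniz (ε : ℤˣ) (f : C^∞⟮𝓡 d, M; ℝ⟯) (X Y : VField d M) (x : M) :
    G.nablaPM ε X (fsmul f Y) x =
      f x • G.nablaPM ε X Y x + dirDeriv f x (X x) • Y x := by
  have h := sgn_mul_self ε
  simp only [nablaPM_apply, liftSec_fsmul, A.leibniz, anchor_liftSec, map_add, map_smul,
    endo_liftSec, smul_add, smul_smul]
  rw [show 1 / 2 * (sgn ε * (dirDeriv (⇑f) x (X x) * sgn ε)) = (1 / 2) * dirDeriv (⇑f) x (X x) by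
    linear_combination (1 / 2) * dirDeriv (⇑f) x (X x) * h]
  module

theorem nablaPM_fsmul_left (ε : ℤˣ) (f : C^∞⟮𝓡 d, M; ℝ⟯) (X Y : VField d M) :
    G.nablaPM ε (fsmul f X) Y = fsmul f (G.nablaPM ε X Y) := by
  ext1 x
  have h := sgn_mul_self ε
  rw [fsmul_vfield_apply, nablaPM_apply, nablaPM_apply, bracket_lift_swap, bracket_lift_swap]
  simp only [liftSec_fsmul, ContMDiffSection.coe_neg,
    Pi.neg_apply, A.leibniz, anchor_liftSec, map_add, map_smul, map_neg,
    endo_liftSec, smul_add, smul_smul, smul_neg, sgn_neg]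
  rw [show 1 / 2 * (sgn ε * (dirDeriv (⇑f) x (Y x) * -sgn ε)) = -(1 / 2 * dirDeriv (⇑f) x (Y x)) by
    linear_combination -(1 / 2) * dirDeriv (⇑f) x (Y x) * h]
  module

theorem anchor_bracket_lift (ε ε' : ℤˣ) (X Y : VField d M) (x : M) :
    A.anchor x (A.bracket (G.liftSec ε X) (G.liftSec ε' Y) x) =
      VectorField.mlieBracket (𝓡 d) X Y x := by
  rw [A.anchor_bracket]
  simp only [anchor_liftSec]

theorem leviCivita_torsion (X Y : VField d M) (x : M) :
    G.leviCivita X Y x - G.leviCivita Y X x = VectorField.mlieBracket (𝓡 d) X Y x := by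
  have h1 := G.anchor_bracket_lift (-1) 1 X Y x
  have h2 := G.anchor_bracket_lift 1 (-1) X Y x
  have s1 : A.bracket (G.liftSec (-1) Y) (G.liftSec 1 X) =
      -A.bracket (G.liftSec 1 X) (G.liftSec (-1) Y) := G.bracket_lift_swap 1 Y X
  have s2 : A.bracket (G.liftSec 1 Y) (G.liftSec (-1) X) =
      -A.bracket (G.liftSec (-1) X) (G.liftSec 1 Y) := by
    rw [G.bracket_lift_swap 1 X Y, neg_neg]
  simp only [leviCivita_apply, nablaPM_apply, neg_neg, s1, s2, ContMDiffSection.coe_neg,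
    Pi.neg_apply, map_neg, map_add, map_smul, smul_add, smul_neg, h1, h2, sgn_neg]
  module

/-- `leviCivita` is the Levi-Civita connection of the induced metric. -/
theorem isLeviCivita_leviCivita : IsLeviCivita G.metric G.leviCivita where
  add_left X X' Y := by
    simp only [leviCivita, nablaPM_add_left]
    module
  fsmul_left f X Y := by
    ext1 x
    rw [fsmul_vfield_apply]
    simp only [leviCivita_apply, nablaPM_fsmul_left, fsmul_vfield_apply]
    module
  add_right X Y Y' := by
    simp only [leviCivita, nablaPM_add_right]
    module
  leibniz f X Y x := by
    simp only [leviCivita_apply, nablaPM_leibniz]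
    module
  torsion_free := G.leviCivita_torsion
  metric X Y Z x := by
    have h1 := G.nablaPM_metric 1 X Y Z x
    have h2 := G.nablaPM_metric (-1) X Y Z x
    rw [G.metric_symm x (Y x)] at h1 h2 ⊢
    simp only [leviCivita_apply, metric_smul_left, metric_add_left]
    linarith



/-- The Lie bracket of smooth vector fields. -/
noncomputable def lieBracket (X Y : VField d M) : VField d M :=
  ⟨VectorField.mlieBracket (𝓡 d) X Y, by
    have : IsManifold (𝓡 d) (((⊤ : ℕ∞) : WithTop ℕ∞) + 1) M := by simpa
    have : IsManifold (𝓡 d) (minSmoothness ℝ 2) M := by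
      rw [minSmoothness_of_isRCLikeNormedField]
      exact IsManifold.of_le (n := ∞) (WithTop.coe_le_coe.2 le_top)
    exact ContDiff.mlieBracket_vectorField (m := ⊤) (n := ⊤) X.contMDiff Y.contMDiff (by simp)⟩

/-- The Riemann tensor of the induced metric, `Rm(X,Y,Z,W) = g(R(Z,W)Y, X)` with
`R(Z,W) = ∇_Z ∇_W - ∇_W ∇_Z - ∇_[Z,W]`. -/
noncomputable def riemann (X Y Z W : VField d M) (x : M) : ℝ :=
  G.metric x ((G.leviCivita Z (G.leviCivita W Y) - G.leviCivita W (G.leviCivita Z Y) -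
    G.leviCivita (lieBracket Z W) Y) x) (X x)

/-- The isotropic splitting `σ : TM → V` of the anchor determined by the generalised metric, whose
image is the `𝒢`-orthogonal complement of `T*M`. -/
noncomputable def split (X : VField d M) : Sec d F V :=
  (1 / 2 : ℝ) • (G.liftSec 1 X + G.liftSec (-1) X)

/-- The three-form `H(X,Y,Z) = 2⟨[σX,σY],σZ⟩`. With `V` identified with `TM ⊕ T*M` through `σ`, such
that `⟨X+ξ,Y+η⟩ = ½(ξ(Y) + η(X))`, this means `[X,Y] = [X,Y]_{Lie} + H(X,Y,·)`. -/
noncomputable def flux (X Y Z : VField d M) (x : M) : ℝ :=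
  2 * A.pairing x (A.bracket (G.split X) (G.split Y) x) (G.split Z x)

/-- The vector field metrically dual to the one-form `H(X,Y,·)`, see `metric_fluxVec`. -/
noncomputable def fluxVec (X Y : VField d M) : VField d M :=
  G.anch (mapSec G.endo G.endo_smooth (A.bracket (G.split X) (G.split Y)))

theorem metric_fluxVec (X Y Z : VField d M) (x : M) :
    G.metric x (G.fluxVec X Y x) (Z x) = G.flux X Y Z x := by
  have h1 := G.pairing_proj_lift 1 (A.bracket (G.split X) (G.split Y)) x (Z x)
  have h2 := G.pairing_proj_lift (-1) (A.bracket (G.split X) (G.split Y)) x (Z x)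
  have h3 : G.fluxVec X Y x =
      A.anchor x (G.proj 1 (A.bracket (G.split X) (G.split Y)) x) +
        (-1 : ℝ) • A.anchor x (G.proj (-1) (A.bracket (G.split X) (G.split Y)) x) := by
    have : G.fluxVec X Y x =
      A.anchor x (G.endo x (A.bracket (G.split X) (G.split Y) x)) := rfl
    rw [this]
    simp only [proj_apply, map_smul, map_add, sgn]
    simp only [Units.val_neg, Units.val_one, Int.reduceNeg, Int.cast_neg, Int.cast_one]
    module
  have h4 : G.split Z x = (1 / 2 : ℝ) • (G.lift 1 x (Z x) + G.lift (-1) x (Z x)) := rfl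
  simp only [sgn, Units.val_neg, Units.val_one, Int.reduceNeg, Int.cast_neg, Int.cast_one,
    neg_mul, one_mul] at h1 h2
  rw [h3, metric_add_left, metric_smul_left, flux, h4, map_smul, map_add, h1, h2, smul_eq_mul]
  ring

/-- `H⁽²⁾(X,Y,Z,W) = g(H(X,Y,·), H(Z,W,·))`. -/
noncomputable def flux2 (X Y Z W : VField d M) (x : M) : ℝ :=
  G.metric x (G.fluxVec X Y x) (G.fluxVec Z W x)

/-- The part of the canonical connection with values in `E_±`: for `u` in `E_∓` and `v` in `E_±` it
is `[u,v]_±`, for `u, v` in `E_±` it is the lift to `E_±` of `(∇ ± ⅙H)_{πu}(πv)`. -/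
noncomputable def canonicalPart (ε : ℤˣ) (u v : Sec d F V) : Sec d F V :=
  G.proj ε (A.bracket (G.proj (-ε) u) (G.proj ε v)) +
    G.liftSec ε (G.leviCivita (G.anch (G.proj ε u)) (G.anch (G.proj ε v)) +
      (sgn ε / 6) • G.fluxVec (G.anch (G.proj ε u)) (G.anch (G.proj ε v)))

/-- The canonical generalised Levi-Civita connection `D⁰` with metric divergence. -/
noncomputable def canonicalZero (u v : Sec d F V) : Sec d F V :=
  G.canonicalPart 1 u v + G.canonicalPart (-1) u v

theorem finiteDimensional_tangentSpace (x : M) : FiniteDimensional ℝ (TangentSpace (𝓡 d) x) :=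
  inferInstanceAs (FiniteDimensional ℝ (EuclideanSpace ℝ (Fin d)))

/-- The metric divergence operator `div^𝒢(u) = div_g(πu)`, where `div_g(X)` is the trace of `∇X`. -/
noncomputable def divMetric (u : Sec d F V) (x : M) : ℝ :=
  have := finiteDimensional_tangentSpace (d := d) x
  ∑ j, (Module.finBasis ℝ (TangentSpace (𝓡 d) x)).coord j
    (G.leviCivita (extendSec x (Module.finBasis ℝ (TangentSpace (𝓡 d) x) j)) (G.anch u) x)

/-- The divergence operator `div = div^𝒢 - ⟨e,·⟩`. -/
noncomputable def divergence (e u : Sec d F V) (x : M) : ℝ :=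
  G.divMetric u x - A.pairing x (e x) (u x)

/-- The tensor `χ_±^{e_±}(u,v) = ⟨u,v⟩ e_± - ⟨e_±,v⟩ u` for `u, v` in `E_±`, extended by zero to `V`
by means of the projection to `E_±`. -/
noncomputable def chi (ε : ℤˣ) (e : Sec d F V) (x : M) (u v : V x) : V x :=
  A.pairing x (G.projAt ε x u) (G.projAt ε x v) • G.projAt ε x (e x) -
    A.pairing x (G.projAt ε x (e x)) (G.projAt ε x v) • G.projAt ε x u

/-- The trilinear form `χ_±^{e_±}(u,v,w) = ⟨χ_±^{e_±}(u,v),w⟩`. -/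
noncomputable def chiForm (ε : ℤˣ) (e : Sec d F V) (x : M) (u v w : V x) : ℝ :=
  A.pairing x (G.chi ε e x u v) w

end leviCivita
end GeneralisedMetric

section curvature
variable [FiniteDimensional ℝ F] [T2Space M] [ContMDiffVectorBundle ∞ F V (𝓡 d)]

/-- The covariant derivative `[D_v T](u₁,u₂,u₃)` of a trilinear form `T` on `V`. -/
noncomputable def covDerivForm (A : ExactCourantAlgebroid d F V)
    (D : Sec d F V → Sec d F V → Sec d F V)
    (T : Π x, V x → V x → V x → ℝ) (v u₁ u₂ u₃ : Sec d F V) (x : M) : ℝ :=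
  dirDeriv (fun y ↦ T y (u₁ y) (u₂ y) (u₃ y)) x (A.anchor x (v x)) -
    T x (D v u₁ x) (u₂ x) (u₃ x) - T x (u₁ x) (D v u₂ x) (u₃ x) - T x (u₁ x) (u₂ x) (D v u₃ x)

/-- The pairing on a fibre as a bilinear form. -/
noncomputable def pairingForm (A : ExactCourantAlgebroid d F V) (x : M) :
    LinearMap.BilinForm ℝ (V x) :=
  LinearMap.mk₂ ℝ (fun u v ↦ A.pairing x u v) (by simp) (by simp) (by simp) (by simp)

theorem pairingForm_nondegenerate (A : ExactCourantAlgebroid d F V) (x : M) :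
    (pairingForm A x).Nondegenerate := by
  constructor
  · intro u hu
    exact A.pairing_nondeg x u hu
  · intro u hu
    exact A.pairing_nondeg x u fun v ↦ (A.pairing_symm x u v).trans (hu v)

/-- A basis `e_i` of the fibre at `x`. -/
noncomputable def frame (d : ℕ) {M : Type*} [TopologicalSpace M]
    [ChartedSpace (EuclideanSpace ℝ (Fin d)) M] (F : Type*) [NormedAddCommGroup F]
    [NormedSpace ℝ F] [FiniteDimensional ℝ F] (V : M → Type*) [TopologicalSpace (TotalSpace F V)]
    [∀ x, AddCommGroup (V x)] [∀ x, Module ℝ (V x)] [∀ x, TopologicalSpace (V x)]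
    [FiberBundle F V] [VectorBundle ℝ F V] (x : M) :
    Module.Basis (Fin (Module.finrank ℝ (V x))) ℝ (V x) :=
  have : FiniteDimensional ℝ (V x) := VectorBundle.finiteDimensional ℝ F V x
  Module.finBasis ℝ (V x)

/-- The basis `e^i` dual to `e_i` with respect to the pairing, `⟨e^i,e_j⟩ = δ_ij`. -/
noncomputable def coframe (A : ExactCourantAlgebroid d F V) (x : M) :
    Module.Basis (Fin (Module.finrank ℝ (V x))) ℝ (V x) :=
  have : FiniteDimensional ℝ (V x) := VectorBundle.finiteDimensional ℝ F V x
  (pairingForm A x).dualBasis (pairingForm_nondegenerate A x) (frame d F V x)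

/-- The trace `∑ i, T(e_i, e^i)` with respect to the pairing of a tensor `T`, given as a
function-bilinear map on sections. -/
noncomputable def traceE (A : ExactCourantAlgebroid d F V)
    (T : Sec d F V → Sec d F V → M → ℝ) (x : M) : ℝ :=
  ∑ i, T (extendSec x (frame d F V x i)) (extendSec x (coframe A x i)) x

/-- The generalised Riemann tensor of a generalised connection `D`,
`Rm^D(a,b,v,w) = ½ { ⟨D_v D_w b - D_w D_v b - D_[v,w] b, a⟩ + ⟨D_b D_a v - D_a D_b v - D_[b,a] v, w⟩`
`+ tr_E ⟨Dv,w⟩⟨Db,a⟩ }`. -/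
noncomputable def genRiemann (A : ExactCourantAlgebroid d F V)
    (D : Sec d F V → Sec d F V → Sec d F V) (a b v w : Sec d F V) (x : M) : ℝ :=
  (1 / 2) * (A.pairing x ((D v (D w b) - D w (D v b) - D (A.bracket v w) b) x) (a x) +
    A.pairing x ((D b (D a v) - D a (D b v) - D (A.bracket b a) v) x) (w x) +
    traceE A (fun s t y ↦ A.pairing y (D s v y) (w y) * A.pairing y (D t b y) (a y)) x)

/-- The fibre at `x` of `so(V)^⟨1⟩_𝒢`: the tensors `S ∈ V* ⊗ so(V)`, `(u,v) ↦ S_u v`, with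
`S_u` commuting with `τ` and vanishing cyclic sum of `⟨S_u v,w⟩`. -/
structure InProlongation {A : ExactCourantAlgebroid d F V} (G : GeneralisedMetric A) (x : M)
    (S : V x →ₗ[ℝ] V x →ₗ[ℝ] V x) : Prop where
  skew : ∀ u v w, A.pairing x (S u v) w = -A.pairing x v (S u w)
  comm : ∀ u v, S u (G.endo x v) = G.endo x (S u v)
  cyclic : ∀ u v w, A.pairing x (S u v) w + A.pairing x (S v w) u + A.pairing x (S w u) v = 0

/-- A smooth section of `so(V)^⟨1⟩_𝒢`. -/
structure ProlongationSection {A : ExactCourantAlgebroid d F V} (G : GeneralisedMetric A) where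
  toFun : Π x, V x →ₗ[ℝ] V x →ₗ[ℝ] V x
  smooth : ∀ u v : Sec d F V, ContMDiff (𝓡 d) ((𝓡 d).prod 𝓘(ℝ, F)) ∞
    (fun x ↦ TotalSpace.mk' F (E := V) x (toFun x (u x) (v x)))
  mem : ∀ x, InProlongation G x (toFun x)

/-- The map `tr : so(V)^⟨1⟩_𝒢 → V*`, `(tr S)(v) = tr(u ↦ S_u v)`. -/
noncomputable def prolongationTrace {x : M} (S : V x →ₗ[ℝ] V x →ₗ[ℝ] V x) (v : V x) : ℝ :=
  LinearMap.trace ℝ (V x) (S.flip v)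

/-- The scalar product of tensors `S(u,v,w) = ⟨S_u v,w⟩` induced by the pairing. -/
noncomputable def tensorPairing (A : ExactCourantAlgebroid d F V) (x : M)
    (S T : V x →ₗ[ℝ] V x →ₗ[ℝ] V x) : ℝ :=
  ∑ i, ∑ j, ∑ k,
    A.pairing x (S (frame d F V x i) (frame d F V x j)) (frame d F V x k) *
      A.pairing x (T (coframe A x i) (coframe A x j)) (coframe A x k)

namespace ProlongationSection

variable {A : ExactCourantAlgebroid d F V} {G : GeneralisedMetric A}

/-- The action `(u,v) ↦ S_u v` on smooth sections. -/
noncomputable def apply (S : ProlongationSection G) (u v : Sec d F V) : Sec d F V :=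
  ⟨fun x ↦ S.toFun x (u x) (v x), S.smooth u v⟩

/-- `S` is the section of `so(V)^⟨1⟩_𝒢` defining the canonical connection with divergence
`div = div^𝒢 - ⟨e,·⟩`: it is orthogonal to `ker tr` and satisfies `div^𝒢 + tr S = div`. -/
structure IsCanonical (S : ProlongationSection G) (e : Sec d F V) : Prop where
  orthogonal : ∀ x, ∀ T : V x →ₗ[ℝ] V x →ₗ[ℝ] V x, InProlongation G x T →
    prolongationTrace T = 0 → tensorPairing A x (S.toFun x) T = 0
  trace : ∀ (u : Sec d F V) (x : M),
    G.divMetric u x + prolongationTrace (S.toFun x) (u x) = G.divergence e u x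

/-- The connection `D⁰ + S`; if `S` is canonical for `e`, this is the canonical generalised
Levi-Civita connection `D^{𝒢,div}` with divergence `div = div^𝒢 - ⟨e,·⟩`. -/
noncomputable def connection (S : ProlongationSection G) (u v : Sec d F V) : Sec d F V :=
  G.canonicalZero u v + S.apply u v

end ProlongationSection
end curvature
end main
end GenGeom

namespace GenGeom

section
variable {d : ℕ} {M : Type*} [TopologicalSpace M] [ChartedSpace (EuclideanSpace ℝ (Fin d)) M]
  [IsManifold (𝓡 d) ∞ M]
  {F : Type*} [NormedAddCommGroup F] [NormedSpace ℝ F]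
  {V : M → Type*} [TopologicalSpace (TotalSpace F V)] [∀ x, AddCommGroup (V x)]
  [∀ x, Module ℝ (V x)] [∀ x, TopologicalSpace (V x)]
  [∀ x, IsTopologicalAddGroup (V x)] [∀ x, ContinuousSMul ℝ (V x)]
  [FiberBundle F V] [VectorBundle ℝ F V]
  [FiniteDimensional ℝ F] [T2Space M] [ContMDiffVectorBundle ∞ F V (𝓡 d)]

/-! The anchor identifies sections of `E_ε` with vector fields, so the whole computation is moved to
`TM`. The brackets of lifts define two metric connections `∇^ε_X Y = π[X^{-ε}, Y^ε]_ε`. Their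
difference is `H` (`flux_eq`), so `H` is totally skew and `∇^ε = ∇ + (ε/2) H` (`nablaPM_eq`). The
Jacobi identity of the Courant bracket gives `dH = 0` (`flux_closed`).

The tensor `S` is known only through its trace and its orthogonality to `ker tr`. Pairing `S` with
`hookMap` evaluates `S` on three vectors, and pairing it with `χ^f` evaluates `tr S` on `f`. A
suitable difference of the two is trace-free, and orthogonality to it forces `S = χ^{e_ε}/(d - 1)`
on `E_ε` (`IsCanonical.pairing_apply`).

On `E_ε` the connection `D` is thus the lift of `∇ + (ε/6) H + S`, while differentiation along
`E_{-ε}` is a bracket. The latter enters the generalised Riemann tensor only through `D_{[v,w]}`,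
`D_{[b,a]}` and the trace. Let `N(X,Y) = π[X^ε, Y^ε]_{-ε}`, which is not tensorial, and let `δ` be
the tensor `defect` that compares `D` on `E_ε` with `∇^ε`. All terms containing `N` cancel, and
twice the generalised Riemann tensor becomes, up to sign, a sum of two ordinary curvatures plus
`g(δ(X,Y), δ(Z,W))` (`IsCanonical.genRiemann_liftSec`).

It remains to expand. The two Levi-Civita curvatures agree by pair symmetry, and the terms in `∇H`
add up to `dH = 0` (`curvForm_twistedConnection_add`). The terms linear in `S` are the derivatives
of `χ` (`IsCanonical.covDerivForm_chiForm`) and a torsion term; the latter cancels the mixed terms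
of `g(δ, δ)`, which leaves the last `H^(2)` term and the terms quadratic in `e_ε`
(`IsCanonical.quadratic`). -/

theorem dirDeriv_add {f g : M → ℝ} {x : M} (hf : MDifferentiableAt (𝓡 d) 𝓘(ℝ) f x)
    (hg : MDifferentiableAt (𝓡 d) 𝓘(ℝ) g x) (X : TangentSpace (𝓡 d) x) :
    dirDeriv (fun y ↦ f y + g y) x X = dirDeriv f x X + dirDeriv g x X := by
  simp only [dirDeriv]
  rw [mvfderiv_fun_add hf hg]
  rfl

theorem dirDeriv_const_mul {f : M → ℝ} {x : M} (hf : MDifferentiableAt (𝓡 d) 𝓘(ℝ) f x) (c : ℝ)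
    (X : TangentSpace (𝓡 d) x) :
    dirDeriv (fun y ↦ c * f y) x X = c * dirDeriv f x X := by
  simp only [dirDeriv]
  rw [mvfderiv_fun_mul mdifferentiableAt_const hf, mvfderiv_const]
  simp

theorem dirDeriv_zero (x : M) (X : TangentSpace (𝓡 d) x) : dirDeriv (fun _ ↦ 0) x X = 0 := by
  simp [dirDeriv, mvfderiv_const]

namespace GeneralisedMetric
variable {A : ExactCourantAlgebroid d F V} (G : GeneralisedMetric A)

/-! ### The induced metric and the brackets of lifted vector fields. -/

theorem metric_add_right (x : M) (X Y Z : TangentSpace (𝓡 d) x) :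
    G.metric x X (Y + Z) = G.metric x X Y + G.metric x X Z := by simp [metric]

theorem metric_smul_right (x : M) (c : ℝ) (X Z : TangentSpace (𝓡 d) x) :
    G.metric x X (c • Z) = c * G.metric x X Z := by simp [metric]

theorem metric_neg_left (x : M) (X Z : TangentSpace (𝓡 d) x) :
    G.metric x (-X) Z = -G.metric x X Z := by simp [metric]

theorem metric_neg_right (x : M) (X Z : TangentSpace (𝓡 d) x) :
    G.metric x X (-Z) = -G.metric x X Z := by simp [metric]

theorem metric_sub_left (x : M) (X Y Z : TangentSpace (𝓡 d) x) :
    G.metric x (X - Y) Z = G.metric x X Z - G.metric x Y Z := by simp [metric]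

theorem metric_sub_right (x : M) (X Y Z : TangentSpace (𝓡 d) x) :
    G.metric x X (Y - Z) = G.metric x X Y - G.metric x X Z := by simp [metric]

/-- For every `u`, the pairing of `X^+` with `u` is `g(X, π u_+)`, so nondegeneracy is inherited
from the pairing on `E`. -/
theorem metric_nondegenerate {x : M} {X : TangentSpace (𝓡 d) x}
    (h : ∀ Z, G.metric x X Z = 0) : X = 0 := by
  rw [← G.anchor_lift 1 x X, A.pairing_nondeg x (G.lift 1 x X) (fun u ↦ ?_), map_zero]
  have h1 := G.pairing_proj_lift 1 (extendSec x u) x X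
  rw [extendSec_apply, G.metric_symm, h, mul_zero] at h1
  rw [A.pairing_symm, h1]

theorem vfield_ext_metric {X Y : VField d M}
    (h : ∀ (x : M) (Z : TangentSpace (𝓡 d) x), G.metric x (X x) Z = G.metric x (Y x) Z) :
    X = Y := by
  ext1 x
  rw [← sub_eq_zero]
  refine G.metric_nondegenerate fun Z ↦ ?_
  rw [metric_sub_left, h, sub_self]

theorem mdifferentiableAt_metric (X Y : VField d M) (x : M) :
    MDifferentiableAt (𝓡 d) 𝓘(ℝ) (fun y ↦ G.metric y (X y) (Y y)) x :=
  mdifferentiableAt_pairing (A := A) (G.liftSec 1 X) (G.liftSec 1 Y) x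

/-- The bracket of two sections of `E_±`, paired with a section of `E_∓`. -/
theorem pairing_bracket_lift_neg (ε : ℤˣ) (X Y Z : VField d M) (x : M) :
    A.pairing x (A.bracket (G.liftSec ε X) (G.liftSec ε Y) x) (G.liftSec (-ε) Z x) =
      sgn ε * G.metric x (G.nablaPM ε Z X x) (Y x) := by
  have h := A.deriv_pairing (G.liftSec ε X) (G.liftSec ε Y) (G.liftSec (-ε) Z) x
  -- The two eigenbundles are orthogonal, so the derivative term vanishes and `[X^ε, ·]` can be
  -- moved to the other factor. There it is a bracket of sections of opposite type, which is
  -- skew-symmetric.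
  have h0 : (fun y ↦ A.pairing y (G.liftSec ε Y y) (G.liftSec (-ε) Z y)) = fun _ ↦ 0 := by
    funext y
    rw [A.pairing_symm]
    exact G.pairing_liftSec_neg ε Z Y y
  have h1 := G.bracket_lift_swap ε Z X
  have h2 := G.metric_nablaPM ε Z X Y x
  rw [h0, dirDeriv_zero, A.pairing_symm x (G.liftSec ε Y x)] at h
  rw [h1] at h2
  simp only [ContMDiffSection.coe_neg, Pi.neg_apply, map_neg, neg_apply] at h2
  linarith

/-- The anchor of `[X^{-ε}, Y^ε]` is the Lie bracket. Its `E_ε`-part is `∇^ε_X Y` by definition; by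
skew-symmetry of mixed brackets its `E_{-ε}`-part is `-∇^{-ε}_Y X`. -/
theorem nablaPM_sub_nablaPM_neg (ε : ℤˣ) (X Y : VField d M) :
    G.nablaPM ε X Y - G.nablaPM (-ε) Y X = lieBracket X Y := by
  ext1 x
  have h := G.anchor_bracket_lift (-ε) ε X Y x
  change _ = VectorField.mlieBracket (𝓡 d) X Y x
  rw [← h]
  simp only [ContMDiffSection.coe_sub, Pi.sub_apply, nablaPM_apply, neg_neg,
    show A.bracket (G.liftSec ε Y) (G.liftSec (-ε) X) =
      -A.bracket (G.liftSec (-ε) X) (G.liftSec ε Y) by rw [G.bracket_lift_swap ε X Y, neg_neg],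
    ContMDiffSection.coe_neg, Pi.neg_apply, map_neg, sgn_neg, map_smul, map_add]
  module

theorem lieBracket_apply (X Y : VField d M) (x : M) :
    (lieBracket X Y : VField d M) x = VectorField.mlieBracket (𝓡 d) X Y x := rfl

theorem anch_bracket (u v : Sec d F V) :
    G.anch (A.bracket u v) = lieBracket (G.anch u) (G.anch v) := by
  ext1 x
  exact A.anchor_bracket u v x

theorem anch_liftSec (ε : ℤˣ) (X : VField d M) : G.anch (G.liftSec ε X) = X := by
  ext1 x
  exact G.anchor_liftSec ε X x

theorem lieBracket_neg_swap (X Y : VField d M) : lieBracket Y X = -lieBracket X Y := by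
  ext1 x
  exact VectorField.mlieBracket_swap_apply

/-- The vector field underlying the `E_∓`-part of the bracket of two sections of `E_±`. -/
theorem metric_anch_proj_neg_bracket (ε : ℤˣ) (X Y Z : VField d M) (x : M) :
    G.metric x (G.anch (G.proj (-ε) (A.bracket (G.liftSec ε X) (G.liftSec ε Y))) x) (Z x) =
      -G.metric x (G.nablaPM ε Z X x) (Y x) := by
  have h := G.pairing_proj_lift (-ε) (A.bracket (G.liftSec ε X) (G.liftSec ε Y)) x (Z x)
  have h1 := G.pairing_bracket_lift_neg ε X Y Z x
  rw [liftSec_apply, h, sgn_neg] at h1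
  have h2 := sgn_mul_self ε
  rw [anch_apply]
  set p := G.metric x (A.anchor x (G.proj (-ε) (A.bracket (G.liftSec ε X) (G.liftSec ε Y)) x)) (Z x)
  linear_combination -sgn ε * h1 - (p + G.metric x (G.nablaPM ε Z X x) (Y x)) * h2

/-- The two components of the bracket have anchors adding up to `[X,Y]`, so the `E_ε`-component is
found from the `E_{-ε}`-component. -/
theorem pairing_bracket_lift (ε : ℤˣ) (X Y Z : VField d M) (x : M) :
    A.pairing x (A.bracket (G.liftSec ε X) (G.liftSec ε Y) x) (G.liftSec ε Z x) =
      sgn ε * (G.metric x (lieBracket X Y x) (Z x) +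
        G.metric x (G.nablaPM ε Z X x) (Y x)) := by
  have h := G.pairing_proj_lift ε (A.bracket (G.liftSec ε X) (G.liftSec ε Y)) x (Z x)
  have h' := G.pairing_proj_lift (-ε) (A.bracket (G.liftSec ε X) (G.liftSec ε Y)) x (Z x)
  have h1 := G.pairing_bracket_lift_neg ε X Y Z x
  rw [liftSec_apply, h', sgn_neg] at h1
  have h2 : (lieBracket X Y : VField d M) x =
      A.anchor x (G.proj ε (A.bracket (G.liftSec ε X) (G.liftSec ε Y)) x) +
      A.anchor x (G.proj (-ε) (A.bracket (G.liftSec ε X) (G.liftSec ε Y)) x) := by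
    rw [← map_add, lieBracket_apply, ← G.anchor_bracket_lift ε ε]
    exact congrArg (fun s : Sec d F V ↦ A.anchor x (s x)) (G.proj_add_proj_neg ε _).symm
  rw [h2, metric_add_left, liftSec_apply, h]
  linear_combination h1

/-! ### The flux as the difference of the two connections. -/

theorem nablaPM_skew_diff (X Y : VField d M) :
    G.nablaPM 1 X Y - G.nablaPM (-1) X Y = -(G.nablaPM 1 Y X - G.nablaPM (-1) Y X) := by
  have h1 := G.nablaPM_sub_nablaPM_neg 1 X Y
  have h2 := G.nablaPM_sub_nablaPM_neg 1 Y X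
  rw [lieBracket_neg_swap, ← h1] at h2
  rw [← sub_eq_zero] at h2 ⊢
  rw [← h2]
  abel

/-- Expanding the splitting as the mean of the two lifts gives eight brackets, each already
expressed through `∇^±`. The rest is linear algebra, using that both connections are metric and that
`∇^+ - ∇^-` is skew in its arguments. -/
theorem flux_eq (X Y Z : VField d M) (x : M) :
    G.flux X Y Z x =
      G.metric x (G.nablaPM 1 X Y x) (Z x) - G.metric x (G.nablaPM (-1) X Y x) (Z x) := by
  have key : G.flux X Y Z x = (1 / 4) *
      (A.pairing x (A.bracket (G.liftSec 1 X) (G.liftSec 1 Y) x) (G.liftSec 1 Z x) +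
       A.pairing x (A.bracket (G.liftSec 1 X) (G.liftSec 1 Y) x) (G.liftSec (-1) Z x) +
       A.pairing x (A.bracket (G.liftSec (-1) X) (G.liftSec (-1) Y) x) (G.liftSec 1 Z x) +
       A.pairing x (A.bracket (G.liftSec (-1) X) (G.liftSec (-1) Y) x) (G.liftSec (-1) Z x) +
       A.pairing x (A.bracket (G.liftSec (-1) X) (G.liftSec 1 Y) x) (G.liftSec 1 Z x) +
       A.pairing x (A.bracket (G.liftSec (-1) X) (G.liftSec 1 Y) x) (G.liftSec (-1) Z x) +
       A.pairing x (A.bracket (G.liftSec 1 X) (G.liftSec (-1) Y) x) (G.liftSec 1 Z x) +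
       A.pairing x (A.bracket (G.liftSec 1 X) (G.liftSec (-1) Y) x) (G.liftSec (-1) Z x)) := by
    simp only [flux, split, map_smul, map_add, LinearMap.smul_apply, LinearMap.add_apply,
      ContMDiffSection.coe_smul, ContMDiffSection.coe_add, Pi.smul_apply, Pi.add_apply,
      smul_apply, add_apply, smul_eq_mul]
    ring
  have s1 := G.bracket_lift_swap 1 Y X
  have s2 := G.bracket_lift_swap (-1) Y X
  have e1 := G.metric_nablaPM 1 X Y Z x
  have e2 := G.metric_nablaPM (-1) X Y Z x
  have e3 := G.metric_nablaPM 1 Y X Z x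
  have e4 := G.metric_nablaPM (-1) Y X Z x
  have f1 := G.pairing_bracket_lift 1 X Y Z x
  have f2 := G.pairing_bracket_lift (-1) X Y Z x
  have f3 := G.pairing_bracket_lift_neg 1 X Y Z x
  have f4 := G.pairing_bracket_lift_neg (-1) X Y Z x
  have m1 := G.nablaPM_metric 1 Z X Y x
  have m2 := G.nablaPM_metric (-1) Z X Y x
  have skew : ∀ P Q R : VField d M,
      G.metric x (G.nablaPM 1 P Q x) (R x) - G.metric x (G.nablaPM (-1) P Q x) (R x) =
      -(G.metric x (G.nablaPM 1 Q P x) (R x) - G.metric x (G.nablaPM (-1) Q P x) (R x)) := by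
    intro P Q R
    have := congrArg (fun U : VField d M ↦ G.metric x (U x) (R x)) (G.nablaPM_skew_diff P Q)
    simpa only [ContMDiffSection.coe_sub, ContMDiffSection.coe_neg, Pi.sub_apply, Pi.neg_apply,
      metric_sub_left, metric_neg_left] using this
  have k1 := skew X Y Z
  have k2 := skew Z X Y
  have n1 := G.nablaPM_metric 1 X Z Y x
  have n2 := G.nablaPM_metric (-1) X Z Y x
  rw [neg_neg] at s2 e2 e4 f4
  rw [s1] at e3
  rw [s2] at e4
  simp only [ContMDiffSection.coe_neg, Pi.neg_apply, map_neg, neg_apply] at e3 e4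
  rw [G.metric_symm x (Z x)] at n1 n2
  simp only [sgn, Units.val_neg, Units.val_one, Int.reduceNeg, Int.cast_neg, Int.cast_one,
    neg_mul, one_mul] at *
  rw [key]
  linarith

theorem fluxVec_eq (X Y : VField d M) : G.fluxVec X Y = G.nablaPM 1 X Y - G.nablaPM (-1) X Y := by
  refine G.vfield_ext_metric fun x Z ↦ ?_
  have h := G.metric_fluxVec X Y (extendSec x Z) x
  rw [flux_eq, extendSec_apply] at h
  rw [h, ContMDiffSection.coe_sub, Pi.sub_apply, metric_sub_left]

theorem fluxVec_swap (X Y : VField d M) : G.fluxVec Y X = -G.fluxVec X Y := by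
  rw [fluxVec_eq, fluxVec_eq, nablaPM_skew_diff]

theorem flux_swap_left (X Y Z : VField d M) (x : M) : G.flux Y X Z x = -G.flux X Y Z x := by
  rw [← metric_fluxVec, ← metric_fluxVec, fluxVec_swap]
  exact G.metric_neg_left _ _ _

/-- Both `∇^+` and `∇^-` are metric, so their difference is a skew endomorphism. -/
theorem flux_swap_right (X Y Z : VField d M) (x : M) : G.flux X Z Y x = -G.flux X Y Z x := by
  have n1 := G.nablaPM_metric 1 X Z Y x
  have n2 := G.nablaPM_metric (-1) X Z Y x
  rw [G.metric_symm x (Z x)] at n1 n2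
  rw [flux_eq, flux_eq]
  linarith

theorem nablaPM_eq (ε : ℤˣ) (X Y : VField d M) :
    G.nablaPM ε X Y = G.leviCivita X Y + (sgn ε / 2) • G.fluxVec X Y := by
  rw [fluxVec_eq, leviCivita]
  rcases Int.units_eq_one_or ε with rfl | rfl
  · simp only [sgn, Units.val_one, Int.cast_one]
    module
  · simp only [sgn, Units.val_neg, Units.val_one, Int.reduceNeg, Int.cast_neg, Int.cast_one]
    module

/-! ### Consequences of the Jacobi identity: commutators of derivatives and closedness of the flux.
-/

/-- Polarisation of `⟨[u,u],v⟩ = ½ π(v)⟨u,u⟩`: it controls the failure of skew-symmetry of the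
bracket. -/
theorem pairing_bracket_add_swap (p q r : Sec d F V) (x : M) :
    A.pairing x (A.bracket p q x) (r x) + A.pairing x (A.bracket q p x) (r x) =
      dirDeriv (fun y ↦ A.pairing y (p y) (q y)) x (A.anchor x (r x)) := by
  have h1 := A.pairing_bracket_self (p + q) r x
  have h2 := A.pairing_bracket_self p r x
  have h3 := A.pairing_bracket_self q r x
  have hf : (fun y ↦ A.pairing y ((p + q) y) ((p + q) y)) = fun y ↦
      (A.pairing y (p y) (p y) + A.pairing y (q y) (q y)) + 2 * A.pairing y (p y) (q y) := by
    funext y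
    have := A.pairing_symm y (q y) (p y)
    simp only [ContMDiffSection.coe_add, Pi.add_apply, map_add, add_apply, this]
    ring
  have d1 : MDifferentiableAt (𝓡 d) 𝓘(ℝ)
      (fun y ↦ A.pairing y (p y) (p y) + A.pairing y (q y) (q y)) x :=
    (mdifferentiableAt_pairing p p x).add (mdifferentiableAt_pairing q q x)
  have d2 : MDifferentiableAt (𝓡 d) 𝓘(ℝ) (fun y ↦ 2 * A.pairing y (p y) (q y)) x :=
    mdifferentiableAt_const.mul (mdifferentiableAt_pairing p q x)
  rw [hf, dirDeriv_add d1 d2,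
    dirDeriv_add (mdifferentiableAt_pairing p p x) (mdifferentiableAt_pairing q q x),
    dirDeriv_const_mul (mdifferentiableAt_pairing p q x)] at h1
  simp only [map_add, LinearMap.add_apply, ContMDiffSection.coe_add, Pi.add_apply,
    add_apply] at h1
  linarith

/-- The commutator formula `[πu, πv] = πu πv - πv πu` is needed only on functions of the form
`⟨p,q⟩`. There it follows from the Courant axioms: differentiate twice by `deriv_pairing`; the mixed
products are symmetric in `u, v`, and the Jacobi identity handles the remaining ones. -/
theorem dirDeriv_lieBracket_pairing (u v p q : Sec d F V) (x : M) :
    dirDeriv (fun y ↦ dirDeriv (fun z ↦ A.pairing z (p z) (q z)) y (A.anchor y (v y))) x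
        (A.anchor x (u x)) -
      dirDeriv (fun y ↦ dirDeriv (fun z ↦ A.pairing z (p z) (q z)) y (A.anchor y (u y))) x
        (A.anchor x (v x)) =
      dirDeriv (fun y ↦ A.pairing y (p y) (q y)) x (A.anchor x (A.bracket u v x)) := by
  have key : ∀ u v : Sec d F V,
      dirDeriv (fun y ↦ dirDeriv (fun z ↦ A.pairing z (p z) (q z)) y (A.anchor y (v y))) x
        (A.anchor x (u x)) =
      A.pairing x (A.bracket u (A.bracket v p) x) (q x) +
      A.pairing x (A.bracket v p x) (A.bracket u q x) +
      (A.pairing x (A.bracket u p x) (A.bracket v q x) +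
      A.pairing x (p x) (A.bracket u (A.bracket v q) x)) := by
    intro u v
    have h : (fun y ↦ dirDeriv (fun z ↦ A.pairing z (p z) (q z)) y (A.anchor y (v y))) =
        fun y ↦ A.pairing y (A.bracket v p y) (q y) + A.pairing y (p y) (A.bracket v q y) := by
      funext y
      exact A.deriv_pairing v p q y
    rw [h, dirDeriv_add (mdifferentiableAt_pairing _ _ x) (mdifferentiableAt_pairing _ _ x),
      A.deriv_pairing, A.deriv_pairing]
  rw [key u v, key v u, A.deriv_pairing, A.jacobi u v p, A.jacobi u v q]
  simp only [ContMDiffSection.coe_add, Pi.add_apply, map_add, add_apply]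
  ring

theorem dirDeriv_lieBracket_metric (X Y Z W : VField d M) (x : M) :
    dirDeriv (fun y ↦ dirDeriv (fun z ↦ G.metric z (Z z) (W z)) y (Y y)) x (X x) -
      dirDeriv (fun y ↦ dirDeriv (fun z ↦ G.metric z (Z z) (W z)) y (X y)) x (Y x) =
      dirDeriv (fun y ↦ G.metric y (Z y) (W y)) x (lieBracket X Y x) := by
  have h := dirDeriv_lieBracket_pairing (A := A) (G.liftSec 1 X) (G.liftSec 1 Y) (G.liftSec 1 Z)
    (G.liftSec 1 W) x
  simp only [anchor_liftSec, anchor_bracket_lift] at h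
  exact h

theorem lieBracket_jacobi (G : GeneralisedMetric A) (X Y Z : VField d M) :
    lieBracket X (lieBracket Y Z) =
      lieBracket (lieBracket X Y) Z + lieBracket Y (lieBracket X Z) := by
  have h := congrArg G.anch (A.jacobi (G.liftSec 1 X) (G.liftSec 1 Y) (G.liftSec 1 Z))
  have h2 : ∀ u v : Sec d F V, G.anch (u + v) = G.anch u + G.anch v := by
    intro u v
    ext1 x
    simp only [anch_apply, ContMDiffSection.coe_add, Pi.add_apply, map_add]
  simpa only [h2, anch_bracket, anch_liftSec] using h

theorem anchor_split (X : VField d M) (x : M) : A.anchor x (G.split X x) = X x := by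
  simp only [split, ContMDiffSection.coe_smul, ContMDiffSection.coe_add, Pi.smul_apply,
    Pi.add_apply, map_smul, map_add, anchor_liftSec]
  module

theorem pairing_split_split (X Y : VField d M) (x : M) :
    A.pairing x (G.split X x) (G.split Y x) = 0 := by
  have h1 := G.pairing_lift_lift 1 x (X x) (Y x)
  have h2 := G.pairing_lift_lift (-1) x (X x) (Y x)
  have h3 := G.pairing_liftSec_neg 1 X Y x
  have h4 := G.pairing_liftSec_neg (-1) X Y x
  rw [neg_neg] at h4
  rw [sgn_neg] at h2
  simp only [split, ContMDiffSection.coe_smul, ContMDiffSection.coe_add, Pi.smul_apply,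
    Pi.add_apply, map_smul, map_add, smul_apply, add_apply, smul_eq_mul]
  simp only [liftSec_apply] at *
  rw [h1, h2, h3, h4]
  ring

/-- The difference `[σX,σY] - σ[X,Y]` lies in `ker π`, which is isotropic, as is the image of `σ`.
-/
theorem pairing_bracket_split_bracket_split (X Y Z W : VField d M) (x : M) :
    A.pairing x (A.bracket (G.split X) (G.split Y) x) (A.bracket (G.split Z) (G.split W) x) =
      (1 / 2) * (G.flux X Y (lieBracket Z W) x + G.flux Z W (lieBracket X Y) x) := by
  have hb : ∀ X Y : VField d M, A.anchor x (A.bracket (G.split X) (G.split Y) x -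
      G.split (lieBracket X Y) x) = 0 := by
    intro X Y
    rw [map_sub, anchor_split, A.anchor_bracket]
    simp only [anchor_split]
    exact sub_self _
  have h := pairing_ker (A := A) (hb X Y) (hb Z W)
  simp only [map_sub, sub_apply, pairing_split_split] at h
  rw [A.pairing_symm x (G.split (lieBracket X Y) x)] at h
  simp only [flux]
  linarith

theorem mdifferentiableAt_flux (X Y Z : VField d M) (x : M) :
    MDifferentiableAt (𝓡 d) 𝓘(ℝ) (fun y ↦ G.flux X Y Z y) x :=
  mdifferentiableAt_const.mul (mdifferentiableAt_pairing (A := A) _ _ x)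

/-- The flux is closed, in terms of Lie brackets. -/
theorem flux_closed_lieBracket (X Y Z W : VField d M) (x : M) :
    dirDeriv (G.flux Y Z W) x (X x) - dirDeriv (G.flux X Z W) x (Y x) +
      dirDeriv (G.flux X Y W) x (Z x) - dirDeriv (G.flux X Y Z) x (W x) =
    G.flux Y Z (lieBracket X W) x + G.flux X W (lieBracket Y Z) x -
      G.flux X Z (lieBracket Y W) x - G.flux Y W (lieBracket X Z) x +
      G.flux X Y (lieBracket Z W) x + G.flux Z W (lieBracket X Y) x := by
  have hd : ∀ P Q R S : VField d M, dirDeriv (G.flux P Q R) x (S x) =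
      2 * dirDeriv (fun y ↦ A.pairing y (A.bracket (G.split P) (G.split Q) y) (G.split R y)) x
        (S x) := by
    intro P Q R S
    exact dirDeriv_const_mul (mdifferentiableAt_pairing (A := A) _ _ x) 2 (S x)
  have key : ∀ P Q R S : VField d M,
      A.pairing x (A.bracket (G.split P) (A.bracket (G.split Q) (G.split R)) x) (G.split S x) =
      (1 / 2) * (dirDeriv (G.flux Q R S) x (P x) - G.flux Q R (lieBracket P S) x -
        G.flux P S (lieBracket Q R) x) := by
    intro P Q R S
    have h := A.deriv_pairing (G.split P) (A.bracket (G.split Q) (G.split R)) (G.split S) x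
    rw [pairing_bracket_split_bracket_split, anchor_split] at h
    rw [hd]
    linarith
  -- The Jacobi identity for the three split sections, paired with `σW`, is `dH = 0`.
  have h1 := congrArg (fun s : Sec d F V ↦ A.pairing x (s x) (G.split W x))
    (A.jacobi (G.split X) (G.split Y) (G.split Z))
  simp only [ContMDiffSection.coe_add, Pi.add_apply, map_add, add_apply] at h1
  -- The term `[[σX,σY],σZ]` has its double bracket on the left, so it is first swapped into the
  -- shape covered by `key`, at the cost of one derivative of the flux.
  have h2 := pairing_bracket_add_swap (A := A) (A.bracket (G.split X) (G.split Y)) (G.split Z)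
    (G.split W) x
  rw [anchor_split] at h2
  have h3 := hd X Y Z W
  rw [key] at h1 h2
  rw [key] at h1
  linarith

theorem flux_sub_right (X Y Z Z' : VField d M) (x : M) :
    G.flux X Y (Z - Z') x = G.flux X Y Z x - G.flux X Y Z' x := by
  simp only [← metric_fluxVec, ContMDiffSection.coe_sub, Pi.sub_apply, metric_sub_right]

theorem lieBracket_eq (X Y : VField d M) :
    lieBracket X Y = G.leviCivita X Y - G.leviCivita Y X := by
  ext1 x
  exact (G.leviCivita_torsion X Y x).symm

/-- The covariant derivative `(∇_X H)(Y,Z,W)`. -/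
noncomputable def nablaFlux (X Y Z W : VField d M) (x : M) : ℝ :=
  dirDeriv (G.flux Y Z W) x (X x) - G.flux (G.leviCivita X Y) Z W x -
    G.flux Y (G.leviCivita X Z) W x - G.flux Y Z (G.leviCivita X W) x

/-- As `∇` is torsion-free, each Lie bracket in `flux_closed_lieBracket` is a difference of
covariant derivatives; total skew-symmetry then regroups the terms. -/
theorem flux_closed (X Y Z W : VField d M) (x : M) :
    G.nablaFlux X Y Z W x - G.nablaFlux Y X Z W x + G.nablaFlux Z X Y W x -
      G.nablaFlux W X Y Z x = 0 := by
  have h := G.flux_closed_lieBracket X Y Z W x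
  simp only [lieBracket_eq G, flux_sub_right] at h
  have lft : ∀ P Q R : VField d M, G.flux P Q R x = G.flux Q R P x := by
    intro P Q R
    rw [G.flux_swap_right Q P R, G.flux_swap_left P Q R, neg_neg]
  simp only [nablaFlux]
  have mid : ∀ P Q R : VField d M, G.flux P Q R x = -G.flux P R Q x :=
    fun P Q R ↦ G.flux_swap_right P R Q x
  rw [lft (G.leviCivita X Y), lft (G.leviCivita Y X), lft (G.leviCivita Z X),
    lft (G.leviCivita W X), mid Y (G.leviCivita X Z), mid X (G.leviCivita Y Z),
    mid X (G.leviCivita Z Y), mid X (G.leviCivita W Y)]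
  linarith

/-! ### Symmetries of the Riemann tensor. -/

theorem metric_leviCivita (X Y Z : VField d M) (x : M) :
    dirDeriv (fun y ↦ G.metric y (Y y) (Z y)) x (X x) =
      G.metric x (G.leviCivita X Y x) (Z x) + G.metric x (Y x) (G.leviCivita X Z x) :=
  G.isLeviCivita_leviCivita.metric X Y Z x

/-- The expression `g(R(Z,W)Y, X)` with `R(Z,W) = D_Z D_W - D_W D_Z - D_[Z,W]`. -/
noncomputable def curvForm (D : VField d M → VField d M → VField d M)
    (X Y Z W : VField d M) (x : M) : ℝ :=
  G.metric x ((D Z (D W Y) - D W (D Z Y) - D (lieBracket Z W) Y) x) (X x)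

/-- Metricity trades second covariant derivatives for derivatives of scalar functions. -/
theorem curvForm_eq {D : VField d M → VField d M → VField d M}
    (hD : ∀ X Y Z x, dirDeriv (fun y ↦ G.metric y (Y y) (Z y)) x (X x) =
      G.metric x (D X Y x) (Z x) + G.metric x (Y x) (D X Z x)) (X Y Z W : VField d M) (x : M) :
    G.curvForm D X Y Z W x =
      dirDeriv (fun y ↦ G.metric y (D W Y y) (X y)) x (Z x) -
      dirDeriv (fun y ↦ G.metric y (D Z Y y) (X y)) x (W x) -
      G.metric x (D W Y x) (D Z X x) + G.metric x (D Z Y x) (D W X x) -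
      G.metric x (D (lieBracket Z W) Y x) (X x) := by
  simp only [curvForm, ContMDiffSection.coe_sub, Pi.sub_apply, metric_sub_left]
  rw [hD, hD]
  ring

/-- The second derivatives of `g(X,Y)` along `Z` and `W` commute up to the derivative along `[Z,W]`;
expanding by metricity gives the skew-symmetry. -/
theorem curvForm_swap_left {D : VField d M → VField d M → VField d M}
    (hD : ∀ X Y Z x, dirDeriv (fun y ↦ G.metric y (Y y) (Z y)) x (X x) =
      G.metric x (D X Y x) (Z x) + G.metric x (Y x) (D X Z x)) (X Y Z W : VField d M) (x : M) :
    G.curvForm D Y X Z W x = -G.curvForm D X Y Z W x := by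
  have h := G.dirDeriv_lieBracket_metric Z W X Y x
  simp only [hD] at h
  rw [dirDeriv_add (G.mdifferentiableAt_metric _ _ x) (G.mdifferentiableAt_metric _ _ x),
    dirDeriv_add (G.mdifferentiableAt_metric _ _ x) (G.mdifferentiableAt_metric _ _ x)] at h
  simp only [curvForm, ContMDiffSection.coe_sub, Pi.sub_apply, metric_sub_left]
  simp only [hD] at h
  rw [G.metric_symm x (X x), G.metric_symm x (X x), G.metric_symm x (X x),
    G.metric_symm x (D Z X x), G.metric_symm x (D W X x)] at h
  linarith

theorem riemann_eq_curvForm (X Y Z W : VField d M) (x : M) :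
    G.riemann X Y Z W x = G.curvForm G.leviCivita X Y Z W x := rfl

theorem riemann_swap_left (X Y Z W : VField d M) (x : M) :
    G.riemann Y X Z W x = -G.riemann X Y Z W x :=
  G.curvForm_swap_left G.metric_leviCivita X Y Z W x

theorem leviCivita_neg_left (X Y : VField d M) : G.leviCivita (-X) Y = -G.leviCivita X Y := by
  have := G.isLeviCivita_leviCivita.add_left X (-X) Y
  have h0 := G.isLeviCivita_leviCivita.add_left 0 0 Y
  rw [add_zero, left_eq_add] at h0
  rw [add_neg_cancel, h0] at this
  exact (neg_eq_of_add_eq_zero_right this.symm).symm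

theorem leviCivita_neg_right (X Y : VField d M) : G.leviCivita X (-Y) = -G.leviCivita X Y := by
  have := G.isLeviCivita_leviCivita.add_right X Y (-Y)
  have h0 := G.isLeviCivita_leviCivita.add_right X 0 0
  rw [add_zero, left_eq_add] at h0
  rw [add_neg_cancel, h0] at this
  exact (neg_eq_of_add_eq_zero_right this.symm).symm

theorem leviCivita_sub_right (X Y Z : VField d M) :
    G.leviCivita X (Y - Z) = G.leviCivita X Y - G.leviCivita X Z := by
  rw [sub_eq_add_neg, G.isLeviCivita_leviCivita.add_right, leviCivita_neg_right, ← sub_eq_add_neg]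

theorem riemann_swap_right (X Y Z W : VField d M) (x : M) :
    G.riemann X Y W Z x = -G.riemann X Y Z W x := by
  simp only [riemann, lieBracket_neg_swap Z W, leviCivita_neg_left, ContMDiffSection.coe_sub,
    Pi.sub_apply, metric_sub_left, ContMDiffSection.coe_neg, Pi.neg_apply, metric_neg_left]
  ring

/-- The Jacobi identity for vector fields, with every Lie bracket rewritten through the torsion-free
connection. -/
theorem riemann_bianchi (X Y Z W : VField d M) (x : M) :
    G.riemann X Y Z W x + G.riemann X Z W Y x + G.riemann X W Y Z x = 0 := by
  have h := congrArg (fun U : VField d M ↦ G.metric x (U x) (X x)) (G.lieBracket_jacobi Y Z W)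
  have e : ∀ P Q R : VField d M, lieBracket P (lieBracket Q R) =
      G.leviCivita P (G.leviCivita Q R) - G.leviCivita P (G.leviCivita R Q) -
        G.leviCivita (lieBracket Q R) P := by
    intro P Q R
    rw [lieBracket_eq G P, ← leviCivita_sub_right, ← lieBracket_eq G Q R]
  rw [lieBracket_neg_swap W (lieBracket Y Z), e, e, e] at h
  have s := lieBracket_neg_swap Y W
  simp only [riemann, s, leviCivita_neg_left, ContMDiffSection.coe_sub, Pi.sub_apply,
    metric_sub_left, ContMDiffSection.coe_add, Pi.add_apply, metric_add_left,
    ContMDiffSection.coe_neg, Pi.neg_apply, metric_neg_left] at *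
  linarith

/-- The classical octahedron argument: a combination of four Bianchi identities, reduced by both
skew-symmetries. -/
theorem riemann_pair_symm (X Y Z W : VField d M) (x : M) :
    G.riemann Z W X Y x = G.riemann X Y Z W x := by
  have b1 := G.riemann_bianchi X Y Z W x
  have b2 := G.riemann_bianchi Y Z W X x
  have b3 := G.riemann_bianchi Z W X Y x
  have b4 := G.riemann_bianchi W X Y Z x
  have l := fun P Q R S : VField d M ↦ G.riemann_swap_left P Q R S x
  have r := fun P Q R S : VField d M ↦ G.riemann_swap_right P Q R S x
  linarith [l X Y Z W, l X Z W Y, l X W Y Z, l Y Z W X, l Y W X Z, l Z W X Y, r X Y Z W,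
    r X Z W Y, r X W Y Z, r Y Z W X, r Y W X Z, r Z W X Y, r Y X Z W, r Z X W Y, r W X Y Z,
    r Z Y W X, r W Y X Z, r W Z X Y]

theorem riemann_reverse (X Y Z W : VField d M) (x : M) :
    G.riemann W Z Y X x = G.riemann X Y Z W x := by
  rw [riemann_swap_left, riemann_swap_right, riemann_pair_symm, neg_neg]

/-! ### Curvature of a metric connection plus a skew tensor, and of `∇ ± ⅙H`. -/

/-- The covariant derivative of the trilinear form `g(C_Y B, Z)` along `X`. -/
noncomputable def covDerivTensor (D C : VField d M → VField d M → VField d M)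
    (X Y B Z : VField d M) (x : M) : ℝ :=
  dirDeriv (fun y ↦ G.metric y (C Y B y) (Z y)) x (X x) - G.metric x (C (D X Y) B x) (Z x) -
    G.metric x (C Y (D X B) x) (Z x) - G.metric x (C Y B x) (D X Z x)

/-- The curvature of the sum of a metric connection and a skew-symmetric tensor. -/
theorem curvForm_add {D C : VField d M → VField d M → VField d M}
    (hD : ∀ X Y Z x, dirDeriv (fun y ↦ G.metric y (Y y) (Z y)) x (X x) =
      G.metric x (D X Y x) (Z x) + G.metric x (Y x) (D X Z x))
    (hC : ∀ X Y Z x, G.metric x (C X Y x) (Z x) = -G.metric x (Y x) (C X Z x))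
    (hCs : ∀ X X' Y, C (X - X') Y = C X Y - C X' Y) (X Y Z W : VField d M) (x : M) :
    G.curvForm (fun X Y ↦ D X Y + C X Y) W Z X Y x =
      G.curvForm D W Z X Y x + G.covDerivTensor D C X Y Z W x - G.covDerivTensor D C Y X Z W x +
      G.metric x (C (D X Y - D Y X - lieBracket X Y) Z x) (W x) -
      G.metric x (C Y Z x) (C X W x) + G.metric x (C X Z x) (C Y W x) := by
  have hDC : ∀ X Y Z x, dirDeriv (fun y ↦ G.metric y (Y y) (Z y)) x (X x) =
      G.metric x ((D X Y + C X Y) x) (Z x) + G.metric x (Y x) ((D X Z + C X Z) x) := by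
    intro X Y Z x
    rw [hD, ContMDiffSection.coe_add, ContMDiffSection.coe_add, Pi.add_apply, Pi.add_apply,
      metric_add_left, metric_add_right, hC]
    ring
  have hs : ∀ X Y Z W : VField d M,
      dirDeriv (fun y ↦ G.metric y ((D X Y + C X Y) y) (Z y)) x (W x) =
      dirDeriv (fun y ↦ G.metric y (D X Y y) (Z y)) x (W x) +
      dirDeriv (fun y ↦ G.metric y (C X Y y) (Z y)) x (W x) := by
    intro X Y Z W
    rw [← dirDeriv_add (G.mdifferentiableAt_metric _ _ x) (G.mdifferentiableAt_metric _ _ x)]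
    simp only [ContMDiffSection.coe_add, Pi.add_apply, metric_add_left]
  rw [G.curvForm_eq hDC, G.curvForm_eq hD, hs, hs]
  simp only [covDerivTensor, hCs, ContMDiffSection.coe_sub, Pi.sub_apply, metric_sub_left,
    ContMDiffSection.coe_add, Pi.add_apply, metric_add_left, metric_add_right]
  rw [hC Y (D X Z), hC X (D Y Z)]
  ring

/-- Linearity in the last slot is visible from the metric, and cyclic symmetry moves it to the
first. -/
theorem fluxVec_sub_left (X X' Y : VField d M) :
    G.fluxVec (X - X') Y = G.fluxVec X Y - G.fluxVec X' Y := by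
  refine G.vfield_ext_metric fun x Z ↦ ?_
  have h := fun P : VField d M ↦ G.metric_fluxVec P Y (extendSec x Z) x
  simp only [extendSec_apply] at h
  have c : ∀ P Q R : VField d M, G.flux P Q R x = G.flux Q R P x := fun P Q R ↦ by
    rw [G.flux_swap_right Q P R, G.flux_swap_left P Q R, neg_neg]
  rw [ContMDiffSection.coe_sub, Pi.sub_apply, metric_sub_left, h, h, h, c, c X, c X',
    flux_sub_right]

theorem flux_cyclic (X Y Z : VField d M) : G.flux X Y Z = G.flux Y Z X := by
  funext x
  rw [G.flux_swap_right Y X Z, G.flux_swap_left X Y Z, neg_neg]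

theorem nablaFlux_cyclic (X Y Z W : VField d M) (x : M) :
    G.nablaFlux X Y Z W x = G.nablaFlux X Z W Y x := by
  simp only [nablaFlux]
  rw [G.flux_cyclic Y Z W, G.flux_cyclic (G.leviCivita X Y), G.flux_cyclic Y (G.leviCivita X Z),
    G.flux_cyclic Y Z (G.leviCivita X W)]
  ring

theorem fluxVec_skew (X Y Z : VField d M) (x : M) :
    G.metric x (G.fluxVec X Y x) (Z x) = -G.metric x (Y x) (G.fluxVec X Z x) := by
  rw [G.metric_symm x (Y x), metric_fluxVec, metric_fluxVec, flux_swap_right]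

/-- The metric connection `∇ ± ⅙H` on `TM`. -/
noncomputable def twistedConnection (ε : ℤˣ) (X Y : VField d M) : VField d M :=
  G.leviCivita X Y + (sgn ε / 6) • G.fluxVec X Y

theorem smul_vfield_apply (c : ℝ) (X : VField d M) (x : M) : (c • X) x = c • X x := rfl

theorem metric_twistedConnection (ε : ℤˣ) (X Y Z : VField d M) (x : M) :
    dirDeriv (fun y ↦ G.metric y (Y y) (Z y)) x (X x) =
      G.metric x (G.twistedConnection ε X Y x) (Z x) +
      G.metric x (Y x) (G.twistedConnection ε X Z x) := by
  simp only [twistedConnection, ContMDiffSection.coe_add, Pi.add_apply, metric_add_left,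
    metric_add_right, smul_vfield_apply, metric_smul_left, metric_smul_right, fluxVec_skew]
  rw [metric_leviCivita]
  ring

theorem twistedConnection_torsion (ε : ℤˣ) (X Y : VField d M) :
    G.twistedConnection ε X Y - G.twistedConnection ε Y X - lieBracket X Y =
      (sgn ε / 3) • G.fluxVec X Y := by
  rw [lieBracket_eq G, twistedConnection, twistedConnection, G.fluxVec_swap X Y]
  module

/-- This is `curvForm_add` with base `∇`, whose vanishing torsion removes the torsion term. The
coefficient `1/36` is `(ε/6)²`. -/
theorem curvForm_twistedConnection (ε : ℤˣ) (X Y Z W : VField d M) (x : M) :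
    G.curvForm (G.twistedConnection ε) W Z X Y x =
      G.riemann W Z X Y x + (sgn ε / 6) * (G.nablaFlux X Y Z W x - G.nablaFlux Y X Z W x) -
      (1 / 36) * G.flux2 Y Z X W x + (1 / 36) * G.flux2 X Z Y W x := by
  have h := G.curvForm_add (C := fun X Y ↦ (sgn ε / 6) • G.fluxVec X Y) G.metric_leviCivita
    (fun X Y Z x ↦ by
      simp only [smul_vfield_apply, metric_smul_left, metric_smul_right, fluxVec_skew]
      ring)
    (fun X X' Y ↦ by simp only [fluxVec_sub_left, smul_sub]) X Y Z W x
  have hc : ∀ X Y, G.covDerivTensor G.leviCivita (fun X Y ↦ (sgn ε / 6) • G.fluxVec X Y) X Y Z W x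
      = (sgn ε / 6) * G.nablaFlux X Y Z W x := by
    intro X Y
    have hd : (fun y ↦ G.metric y ((sgn ε / 6) • G.fluxVec Y Z y) (W y)) =
        fun y ↦ (sgn ε / 6) * G.flux Y Z W y := by
      funext y
      rw [metric_smul_left, metric_fluxVec]
    simp only [covDerivTensor, smul_vfield_apply, nablaFlux]
    rw [hd, dirDeriv_const_mul (G.mdifferentiableAt_flux Y Z W x)]
    simp only [metric_smul_left, metric_fluxVec]
    ring
  have ht : G.leviCivita X Y - G.leviCivita Y X - lieBracket X Y = 0 := by
    rw [lieBracket_eq G, sub_self]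
  have h0 : G.fluxVec 0 Z = 0 := by
    have := G.fluxVec_sub_left 0 0 Z
    rwa [sub_self, sub_self] at this
  rw [hc, hc, ht, h0] at h
  simp only [smul_zero, smul_vfield_apply, metric_smul_left, metric_smul_right] at h
  have hz : G.metric x ((0 : VField d M) x) (W x) = 0 := by
    have := G.metric_smul_left x 0 (W x) (W x)
    rwa [zero_smul, zero_mul] at this
  have hs := sgn_mul_self ε
  change G.curvForm (fun X Y ↦ G.leviCivita X Y + (sgn ε / 6) • G.fluxVec X Y) W Z X Y x = _
  rw [h, hz, ← riemann_eq_curvForm, flux2, flux2]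
  linear_combination (1 / 36) * (G.metric x (G.fluxVec X Z x) (G.fluxVec Y W x) -
    G.metric x (G.fluxVec Y Z x) (G.fluxVec X W x)) * hs

/-- Only the sum of the two curvatures is needed: the terms in `∇H` combine to `dH(X,Y,Z,W) = 0`, so
no derivative of the flux and no sign `ε` survives. -/
theorem curvForm_twistedConnection_add (ε : ℤˣ) (X Y Z W : VField d M) (x : M) :
    G.curvForm (G.twistedConnection ε) W Z X Y x + G.curvForm (G.twistedConnection ε) Y X Z W x =
      2 * G.riemann W Z X Y x - (1 / 18) * G.flux2 W X Z Y x - (1 / 18) * G.flux2 Z X Y W x := by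
  have hcl := G.flux_closed X Y Z W x
  have c2 := G.nablaFlux_cyclic W Z X Y x
  have c3 := G.nablaFlux_cyclic Z W X Y x
  rw [curvForm_twistedConnection, curvForm_twistedConnection, G.riemann_reverse W Z X Y]
  have f : ∀ P Q R S : VField d M, G.flux2 Q P R S x = -G.flux2 P Q R S x := by
    intro P Q R S
    rw [flux2, fluxVec_swap]
    exact G.metric_neg_left _ _ _
  have g : ∀ P Q R S : VField d M, G.flux2 R S P Q x = G.flux2 P Q R S x :=
    fun P Q R S ↦ G.metric_symm _ _ _
  have g' : ∀ P Q R S : VField d M, G.flux2 P Q S R x = -G.flux2 P Q R S x := by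
    intro P Q R S
    rw [g, f, g]
  rw [show G.flux2 Y Z X W x = G.flux2 W X Z Y x by rw [g, f, g', neg_neg],
    f Z X, g' Z X Y W]
  linear_combination (sgn ε / 6) * (hcl + c3 - c2)

end GeneralisedMetric

/-! ### Contractions along a frame and its dual frame. -/

theorem frame_repr (A : ExactCourantAlgebroid d F V) (x : M) (u : V x)
    (i : Fin (Module.finrank ℝ (V x))) :
    (frame d F V x).repr u i = A.pairing x u (coframe A x i) := by
  have : FiniteDimensional ℝ (V x) := VectorBundle.finiteDimensional ℝ F V x
  have h : ∀ i j, A.pairing x (frame d F V x j) (coframe A x i) = if j = i then 1 else 0 := by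
    intro i j
    rw [A.pairing_symm]
    exact LinearMap.BilinForm.apply_dualBasis_left (pairingForm_nondegenerate A x)
      (frame d F V x) i j
  have h2 := congrArg (fun u ↦ A.pairing x u (coframe A x i)) ((frame d F V x).sum_repr u)
  simp only [map_sum, map_smul, sum_apply, smul_apply, h, smul_eq_mul, mul_ite, mul_one,
    mul_zero, Finset.sum_ite_eq', Finset.mem_univ, if_true] at h2
  exact h2

/-- Contraction of a linear form along the frame. -/
theorem sum_frame_coframe (A : ExactCourantAlgebroid d F V) (x : M) (φ : V x →ₗ[ℝ] ℝ) (u : V x) :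
    ∑ i, φ (frame d F V x i) * A.pairing x u (coframe A x i) = φ u := by
  conv_rhs => rw [← (frame d F V x).sum_repr u]
  simp only [map_sum, map_smul, smul_eq_mul, frame_repr A]
  exact Finset.sum_congr rfl fun i _ ↦ mul_comm _ _

theorem sum_frame_pairing (A : ExactCourantAlgebroid d F V) (x : M) (u v : V x) :
    ∑ i, A.pairing x u (frame d F V x i) * A.pairing x v (coframe A x i) = A.pairing x u v :=
  sum_frame_coframe A x (A.pairing x u).toLinearMap v

theorem sum_frame_coframe₂ (A : ExactCourantAlgebroid d F V) (x : M)
    (φ : V x →ₗ[ℝ] V x) (v w : V x) :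
    ∑ j, ∑ k, A.pairing x (φ (frame d F V x j)) (frame d F V x k) *
      (A.pairing x v (coframe A x j) * A.pairing x w (coframe A x k)) =
      A.pairing x (φ v) w := by
  refine Eq.trans ?_ (sum_frame_coframe A x ((pairingForm A x).flip w ∘ₗ φ) v)
  refine Finset.sum_congr rfl fun j _ ↦ ?_
  rw [show ((pairingForm A x).flip w ∘ₗ φ) (frame d F V x j) =
    A.pairing x (φ (frame d F V x j)) w from rfl,
    ← sum_frame_pairing A x (φ (frame d F V x j)) w, Finset.sum_mul]
  exact Finset.sum_congr rfl fun k _ ↦ by ring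

/-- Contracting `S` with a decomposable tensor `u ⊗ v ⊗ w` evaluates it; this turns `tensorPairing`
against explicit tensors into values of `S`. -/
theorem sum_frame_coframe₃ (A : ExactCourantAlgebroid d F V) (x : M)
    (S : V x →ₗ[ℝ] V x →ₗ[ℝ] V x) (u v w : V x) :
    ∑ i, ∑ j, ∑ k, A.pairing x (S (frame d F V x i) (frame d F V x j)) (frame d F V x k) *
      (A.pairing x u (coframe A x i) *
        (A.pairing x v (coframe A x j) * A.pairing x w (coframe A x k))) =
      A.pairing x (S u v) w := by
  refine Eq.trans ?_ (sum_frame_coframe A x ((pairingForm A x).flip w ∘ₗ S.flip v) u)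
  refine Finset.sum_congr rfl fun i _ ↦ ?_
  rw [show ((pairingForm A x).flip w ∘ₗ S.flip v) (frame d F V x i) =
    A.pairing x (S (frame d F V x i) v) w from rfl, ← sum_frame_coframe₂, Finset.sum_mul]
  refine Finset.sum_congr rfl fun j _ ↦ ?_
  rw [Finset.sum_mul]
  exact Finset.sum_congr rfl fun k _ ↦ by ring

theorem trace_eq_sum_frame (A : ExactCourantAlgebroid d F V) (x : M) (φ : V x →ₗ[ℝ] V x) :
    LinearMap.trace ℝ (V x) φ =
      ∑ i, A.pairing x (φ (frame d F V x i)) (coframe A x i) := by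
  rw [LinearMap.trace_eq_matrix_trace ℝ (frame d F V x)]
  simp [Matrix.trace, LinearMap.toMatrix_apply, frame_repr A]

namespace GeneralisedMetric
variable {A : ExactCourantAlgebroid d F V} (G : GeneralisedMetric A)

/-! ### Two families of elements of the prolongation: their traces and scalar products. -/

theorem endo_projAt (ε : ℤˣ) (x : M) (u : V x) :
    G.endo x (G.projAt ε x u) = sgn ε • G.projAt ε x u := by
  have h := G.endo_proj ε (extendSec x u) x
  rwa [proj_eq_projAt, extendSec_apply] at h

theorem projAt_of_mem_eigen {ε : ℤˣ} {x : M} {u : V x} (hu : u ∈ G.eigen ε x) :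
    G.projAt ε x u = u := by
  have h : G.projAt ε x u = (1 / 2 : ℝ) • (u + sgn ε • G.endo x u) := rfl
  rw [h, G.mem_eigen.1 hu, smul_smul, sgn_mul_self]
  module

theorem projAt_neg_of_mem_eigen {ε : ℤˣ} {x : M} {u : V x} (hu : u ∈ G.eigen ε x) :
    G.projAt (-ε) x u = 0 := by
  have h : G.projAt (-ε) x u = (1 / 2 : ℝ) • (u + sgn (-ε) • G.endo x u) := rfl
  rw [h, G.mem_eigen.1 hu, smul_smul, sgn_neg, neg_mul, sgn_mul_self]
  module

theorem pairing_projAt (ε : ℤˣ) (x : M) (u v : V x) :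
    A.pairing x (G.projAt ε x u) v = A.pairing x u (G.projAt ε x v) := by
  have h : ∀ u, G.projAt ε x u = (1 / 2 : ℝ) • (u + sgn ε • G.endo x u) := fun _ ↦ rfl
  have h1 := G.endo_symm x u v
  rw [A.pairing_symm x _ u] at h1
  rw [h, h]
  simp only [map_smul, map_add, smul_apply, add_apply, h1]

/-- The trace of a projection is the rank of its image, and `E_ε` has rank `d` through the anchor.
-/
theorem trace_projAt (ε : ℤˣ) (x : M) : LinearMap.trace ℝ (V x) (G.projAt ε x) = d := by
  have : FiniteDimensional ℝ (V x) := VectorBundle.finiteDimensional ℝ F V x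
  have h : LinearMap.IsProj (G.eigen ε x) (G.projAt ε x) :=
    ⟨fun u ↦ G.endo_projAt ε x u, fun u hu ↦ G.projAt_of_mem_eigen hu⟩
  rw [h.trace, (G.anchorEquiv ε x).finrank_eq]
  have : Module.finrank ℝ (EuclideanSpace ℝ (Fin d)) = d := by simp
  exact congrArg Nat.cast this

/-- The tensor `χ^f` at a point, as a bilinear map. -/
noncomputable def chiMap (ε : ℤˣ) (x : M) (f : V x) : V x →ₗ[ℝ] V x →ₗ[ℝ] V x :=
  LinearMap.mk₂ ℝ (fun u v ↦ A.pairing x (G.projAt ε x u) v • f - A.pairing x f v • G.projAt ε x u)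
    (fun u u' v ↦ by simp only [map_add, add_apply]; module)
    (fun c u v ↦ by simp only [map_smul, smul_apply, smul_eq_mul]; module)
    (fun u v v' ↦ by simp only [map_add]; module)
    (fun c u v ↦ by simp only [map_smul, smul_eq_mul]; module)

theorem chiMap_apply (ε : ℤˣ) (x : M) (f u v : V x) : G.chiMap ε x f u v =
    A.pairing x (G.projAt ε x u) v • f - A.pairing x f v • G.projAt ε x u := rfl

/-- The projection to the prolongation of the tensor `α ⊗ β ⊗ γ`, up to scale. -/
noncomputable def hookMap (_G : GeneralisedMetric A) (x : M) (α β γ : V x) :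
    V x →ₗ[ℝ] V x →ₗ[ℝ] V x :=
  LinearMap.mk₂ ℝ (fun u v ↦ (2 * A.pairing x α u) •
      (A.pairing x β v • γ - A.pairing x γ v • β) -
      A.pairing x α v • (A.pairing x γ u • β - A.pairing x β u • γ) -
      (A.pairing x β u * A.pairing x γ v - A.pairing x γ u * A.pairing x β v) • α)
    (fun u u' v ↦ by simp only [map_add]; module)
    (fun c u v ↦ by simp only [map_smul, smul_eq_mul]; module)
    (fun u v v' ↦ by simp only [map_add]; module)
    (fun c u v ↦ by simp only [map_smul, smul_eq_mul]; module)

theorem hookMap_apply (x : M) (α β γ u v : V x) : G.hookMap x α β γ u v =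
    (2 * A.pairing x α u) • (A.pairing x β v • γ - A.pairing x γ v • β) -
      A.pairing x α v • (A.pairing x γ u • β - A.pairing x β u • γ) -
      (A.pairing x β u * A.pairing x γ v - A.pairing x γ u * A.pairing x β v) • α := rfl

theorem pairing_endo_right {ε : ℤˣ} {x : M} {α : V x} (hα : α ∈ G.eigen ε x) (v : V x) :
    A.pairing x α (G.endo x v) = sgn ε * A.pairing x α v := by
  have h := G.endo_symm x v α
  rw [A.pairing_symm, h, G.mem_eigen.1 hα, map_smul, smul_apply, smul_eq_mul]

theorem inProlongation_chiMap {ε : ℤˣ} {x : M} {f : V x} (hf : f ∈ G.eigen ε x) :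
    InProlongation G x (G.chiMap ε x f) where
  skew u v w := by
    simp only [chiMap_apply, map_sub, map_smul, sub_apply, smul_apply, smul_eq_mul]
    rw [A.pairing_symm x v f, A.pairing_symm x v (G.projAt ε x u)]
    ring
  comm u v := by
    have h1 : A.pairing x (G.projAt ε x u) (G.endo x v) =
        sgn ε * A.pairing x (G.projAt ε x u) v := G.pairing_endo_right (G.endo_projAt ε x u) v
    rw [chiMap_apply, chiMap_apply, map_sub, map_smul, map_smul, G.endo_projAt, G.mem_eigen.1 hf,
      h1, G.pairing_endo_right hf]
    module
  cyclic u v w := by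
    simp only [chiMap_apply, map_sub, map_smul, sub_apply, smul_apply, smul_eq_mul]
    rw [G.pairing_projAt ε x u w, A.pairing_symm x u, G.pairing_projAt ε x v u,
      A.pairing_symm x v, G.pairing_projAt ε x w v, A.pairing_symm x w]
    ring

theorem inProlongation_hookMap {ε : ℤˣ} {x : M} {α β γ : V x} (hα : α ∈ G.eigen ε x)
    (hβ : β ∈ G.eigen ε x) (hγ : γ ∈ G.eigen ε x) : InProlongation G x (G.hookMap x α β γ) where
  skew u v w := by
    simp only [hookMap_apply, map_sub, map_smul, sub_apply, smul_apply, smul_eq_mul]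
    rw [A.pairing_symm x v γ, A.pairing_symm x v β, A.pairing_symm x v α]
    ring
  comm u v := by
    simp only [hookMap_apply, map_sub, map_smul, G.pairing_endo_right hα,
      G.pairing_endo_right hβ, G.pairing_endo_right hγ, G.mem_eigen.1 hα, G.mem_eigen.1 hβ,
      G.mem_eigen.1 hγ]
    module
  cyclic u v w := by
    simp only [hookMap_apply, map_sub, map_smul, sub_apply, smul_apply, smul_eq_mul]
    ring

theorem prolongationTrace_chiMap {ε : ℤˣ} {x : M} {f : V x} (hf : f ∈ G.eigen ε x) (v : V x) :
    prolongationTrace (G.chiMap ε x f) v = (1 - d) * A.pairing x f v := by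
  have : FiniteDimensional ℝ (V x) := VectorBundle.finiteDimensional ℝ F V x
  have h : (G.chiMap ε x f).flip v =
      ((pairingForm A x).flip v ∘ₗ G.projAt ε x).smulRight f -
        A.pairing x f v • G.projAt ε x := rfl
  rw [prolongationTrace, h, map_sub, map_smul, LinearMap.trace_smulRight, trace_projAt]
  have : ((pairingForm A x).flip v ∘ₗ G.projAt ε x) f =
    A.pairing x (G.projAt ε x f) v := rfl
  rw [this, G.projAt_of_mem_eigen hf, smul_eq_mul]
  ring

theorem prolongationTrace_hookMap (x : M) (α β γ v : V x) :
    prolongationTrace (G.hookMap x α β γ) v =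
      3 * (A.pairing x α γ * A.pairing x β v - A.pairing x α β * A.pairing x γ v) := by
  have : FiniteDimensional ℝ (V x) := VectorBundle.finiteDimensional ℝ F V x
  -- Sorting by which of `α, β, γ` is paired with `u` gives three rank-one maps, whose traces are
  -- evaluations.
  have h : (G.hookMap x α β γ).flip v =
      (A.pairing x α).toLinearMap.smulRight
        ((2 : ℝ) • (A.pairing x β v • γ - A.pairing x γ v • β)) -
      (A.pairing x γ).toLinearMap.smulRight (A.pairing x α v • β - A.pairing x β v • α) -
      (A.pairing x β).toLinearMap.smulRight (A.pairing x γ v • α - A.pairing x α v • γ) := by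
    ext u
    simp only [LinearMap.flip_apply, hookMap_apply, LinearMap.sub_apply,
      LinearMap.smulRight_apply, ContinuousLinearMap.coe_coe]
    module
  rw [prolongationTrace, h]
  simp only [map_sub, map_smul, LinearMap.trace_smulRight, ContinuousLinearMap.coe_coe,
    smul_eq_mul]
  rw [A.pairing_symm x γ β, A.pairing_symm x γ α, A.pairing_symm x β α]
  ring

theorem tensorPairing_sub (x : M) (S T T' : V x →ₗ[ℝ] V x →ₗ[ℝ] V x) :
    tensorPairing A x S (T - T') = tensorPairing A x S T - tensorPairing A x S T' := by
  simp only [tensorPairing, LinearMap.sub_apply, map_sub, sub_apply, mul_sub,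
    Finset.sum_sub_distrib]

/-- The contraction gives six permuted values of `S`. Skewness reduces them to the three cyclic
ones, with coefficients `4, -2, -2`, and the cyclic identity turns these into `6`. -/
theorem tensorPairing_hookMap {x : M} {S : V x →ₗ[ℝ] V x →ₗ[ℝ] V x} (hS : InProlongation G x S)
    (α β γ : V x) :
    tensorPairing A x S (G.hookMap x α β γ) = 6 * A.pairing x (S α β) γ := by
  have h : tensorPairing A x S (G.hookMap x α β γ) =
      2 * A.pairing x (S α β) γ - 2 * A.pairing x (S α γ) β - A.pairing x (S γ α) β +
      A.pairing x (S β α) γ - A.pairing x (S β γ) α + A.pairing x (S γ β) α := by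
    rw [← sum_frame_coframe₃ A x S α β γ, ← sum_frame_coframe₃ A x S α γ β,
      ← sum_frame_coframe₃ A x S γ α β, ← sum_frame_coframe₃ A x S β α γ,
      ← sum_frame_coframe₃ A x S β γ α, ← sum_frame_coframe₃ A x S γ β α]
    simp only [Finset.mul_sum, ← Finset.sum_sub_distrib,
      ← Finset.sum_add_distrib, tensorPairing]
    refine Finset.sum_congr rfl fun i _ ↦ Finset.sum_congr rfl fun j _ ↦
      Finset.sum_congr rfl fun k _ ↦ ?_
    simp only [hookMap_apply, map_sub, map_smul, sub_apply, smul_apply, smul_eq_mul]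
    ring
  have s : ∀ u v w, A.pairing x (S u v) w = -A.pairing x (S u w) v := fun u v w ↦ by
    rw [hS.skew, A.pairing_symm]
  rw [h, s α γ β, s β α γ, s γ β α]
  linear_combination -2 * hS.cyclic α β γ

/-- Each of the two terms of `χ^f` contributes `-tr S(f)`, since `S_u` is skew and preserves the
eigenbundle containing `f`. Hence `χ^f` detects only the trace of `S`. -/
theorem tensorPairing_chiMap {ε : ℤˣ} {x : M} {S : V x →ₗ[ℝ] V x →ₗ[ℝ] V x}
    (hS : InProlongation G x S) {f : V x} (hf : f ∈ G.eigen ε x) :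
    tensorPairing A x S (G.chiMap ε x f) = -2 * prolongationTrace S f := by
  have h : tensorPairing A x S (G.chiMap ε x f) =
      ∑ i, (A.pairing x (S (frame d F V x i) (G.projAt ε x (coframe A x i))) f -
        A.pairing x (S (frame d F V x i) f) (G.projAt ε x (coframe A x i))) := by
    rw [tensorPairing]
    refine Finset.sum_congr rfl fun i _ ↦ ?_
    rw [← sum_frame_coframe₂ A x (S (frame d F V x i)) _ f,
      ← sum_frame_coframe₂ A x (S (frame d F V x i)) f]
    simp only [← Finset.sum_sub_distrib]
    refine Finset.sum_congr rfl fun j _ ↦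
      Finset.sum_congr rfl fun k _ ↦ ?_
    simp only [chiMap_apply, map_sub, map_smul, sub_apply, smul_apply, smul_eq_mul]
    ring
  rw [h, prolongationTrace, trace_eq_sum_frame A, Finset.mul_sum]
  refine Finset.sum_congr rfl fun i _ ↦ ?_
  have hm : S (frame d F V x i) f ∈ G.eigen ε x := by
    rw [mem_eigen, ← hS.comm, G.mem_eigen.1 hf, map_smul]
  rw [hS.skew, A.pairing_symm x _ (S _ f), ← G.pairing_projAt, G.projAt_of_mem_eigen hm,
    LinearMap.flip_apply]
  ring

end GeneralisedMetric

theorem InProlongation.sub {A : ExactCourantAlgebroid d F V} {G : GeneralisedMetric A} {x : M}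
    {S T : V x →ₗ[ℝ] V x →ₗ[ℝ] V x} (hS : InProlongation G x S) (hT : InProlongation G x T) :
    InProlongation G x (S - T) where
  skew u v w := by
    simp only [LinearMap.sub_apply, map_sub, sub_apply, hS.skew u v w, hT.skew u v w]
    ring
  comm u v := by simp only [LinearMap.sub_apply, map_sub, hS.comm, hT.comm]
  cyclic u v w := by
    simp only [LinearMap.sub_apply, map_sub, sub_apply]
    linear_combination hS.cyclic u v w - hT.cyclic u v w

theorem prolongationTrace_sub {x : M} (S T : V x →ₗ[ℝ] V x →ₗ[ℝ] V x) (v : V x) :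
    prolongationTrace (S - T) v = prolongationTrace S v - prolongationTrace T v :=
  map_sub (LinearMap.trace ℝ (V x)) (S.flip v) (T.flip v)

/-! ### Determination of the canonical section `S`. -/

namespace ProlongationSection
open GeneralisedMetric
variable {A : ExactCourantAlgebroid d F V} {G : GeneralisedMetric A} {S : ProlongationSection G}

theorem apply_mem_eigen (S : ProlongationSection G) {ε : ℤˣ} {x : M} (u : V x) {v : V x}
    (hv : v ∈ G.eigen ε x) : S.toFun x u v ∈ G.eigen ε x := by
  rw [mem_eigen, ← (S.mem x).comm, G.mem_eigen.1 hv, map_smul]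

/-- Since `S` preserves the eigenbundles, which are orthogonal, two of the three terms of the cyclic
sum vanish; hence so does the third. -/
theorem apply_eq_zero_of_mem_eigen_neg (S : ProlongationSection G) {ε : ℤˣ} {x : M} {u v : V x}
    (hu : u ∈ G.eigen (-ε) x) (hv : v ∈ G.eigen ε x) : S.toFun x u v = 0 := by
  refine A.pairing_nondeg x _ fun w ↦ ?_
  have hm := S.apply_mem_eigen u hv
  rw [← G.projAt_of_mem_eigen hm, G.pairing_projAt]
  have hw : G.projAt ε x w ∈ G.eigen ε x := G.endo_projAt ε x w
  have h := (S.mem x).cyclic u v (G.projAt ε x w)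
  have h1 := G.pairing_eigen_neg (S.apply_mem_eigen v hw) hu
  have h2 := (S.mem x).skew (G.projAt ε x w) u v
  rw [A.pairing_symm x u, G.pairing_eigen_neg (S.apply_mem_eigen _ hv) hu] at h2
  linarith

/-- The canonical section `S` is `(d - 1)⁻¹ χ^{e_±}` on `E_±`. -/
theorem IsCanonical.pairing_apply {e : Sec d F V} (hS : S.IsCanonical e) (hd : d ≠ 1) {ε : ℤˣ}
    {x : M} {α β γ : V x} (hα : α ∈ G.eigen ε x) (hβ : β ∈ G.eigen ε x)
    (hγ : γ ∈ G.eigen ε x) :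
    A.pairing x (S.toFun x α β) γ = 1 / ((d : ℝ) - 1) *
      (A.pairing x α β * A.pairing x (e x) γ - A.pairing x (e x) β * A.pairing x α γ) := by
  have hd' : (d : ℝ) - 1 ≠ 0 := sub_ne_zero.2 (by exact_mod_cast hd)
  -- Chosen so that `χ^f`, of trace `(1 - d)⟨f,·⟩`, has the same trace as `hookMap`; this is where
  -- `d ≠ 1` is needed.
  set f : V x := (-3 / ((d : ℝ) - 1)) • (A.pairing x α γ • β - A.pairing x α β • γ) with hf
  have hfm : f ∈ G.eigen ε x :=
    Submodule.smul_mem _ _ (Submodule.sub_mem _ (Submodule.smul_mem _ _ hβ)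
      (Submodule.smul_mem _ _ hγ))
  have key : ∀ p : V x, A.pairing x f p = -3 / ((d : ℝ) - 1) *
      (A.pairing x α γ * A.pairing x β p - A.pairing x α β * A.pairing x γ p) := by
    intro p
    simp only [hf, map_smul, map_sub, smul_apply, sub_apply, smul_eq_mul]
  have hz : prolongationTrace (G.hookMap x α β γ - G.chiMap ε x f) = 0 := by
    funext v
    rw [prolongationTrace_sub, prolongationTrace_hookMap, G.prolongationTrace_chiMap hfm, key]
    simp only [Pi.zero_apply]
    field_simp
    ring
  have h := hS.orthogonal x _
    ((G.inProlongation_hookMap hα hβ hγ).sub (G.inProlongation_chiMap hfm)) hz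
  rw [tensorPairing_sub, G.tensorPairing_hookMap (S.mem x), G.tensorPairing_chiMap (S.mem x) hfm]
    at h
  -- The divergence condition says `tr S = -⟨e,·⟩`, so `6⟨S_α β, γ⟩ = -2 (tr S)(f) = 2⟨e, f⟩`.
  have ht := hS.trace (extendSec x f) x
  rw [divergence, extendSec_apply, A.pairing_symm, key, A.pairing_symm x β, A.pairing_symm x γ]
    at ht
  have ht' : prolongationTrace (S.toFun x) f = 3 / ((d : ℝ) - 1) *
      (A.pairing x α γ * A.pairing x (e x) β - A.pairing x α β * A.pairing x (e x) γ) := by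
    linear_combination ht
  rw [ht'] at h
  linear_combination (1 / 6) * h
end ProlongationSection

/-! ### The connections `D⁰` and `D` on lifted vector fields. -/

namespace GeneralisedMetric
variable {A : ExactCourantAlgebroid d F V} (G : GeneralisedMetric A)

theorem proj_liftSec (ε : ℤˣ) (X : VField d M) : G.proj ε (G.liftSec ε X) = G.liftSec ε X := by
  ext x
  rw [proj_eq_projAt, G.projAt_of_mem_eigen (G.endo_liftSec ε X x)]

theorem proj_neg_liftSec (ε : ℤˣ) (X : VField d M) : G.proj (-ε) (G.liftSec ε X) = 0 := by
  ext x
  rw [proj_eq_projAt, G.projAt_neg_of_mem_eigen (G.endo_liftSec ε X x)]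
  rfl

theorem liftSec_anch_proj (ε : ℤˣ) (u : Sec d F V) :
    G.liftSec ε (G.anch (G.proj ε u)) = G.proj ε u := by
  ext x
  exact G.lift_anchor (G.endo_proj ε u x)

theorem liftSec_anch {ε : ℤˣ} {u : Sec d F V} (hu : ∀ x, u x ∈ G.eigen ε x) :
    G.liftSec ε (G.anch u) = u := by
  ext x
  exact G.lift_anchor (hu x)

theorem proj_zero (ε : ℤˣ) : G.proj ε (0 : Sec d F V) = 0 := by
  ext x
  exact map_zero (G.projAt ε x)

theorem anch_zero : G.anch (0 : Sec d F V) = 0 := by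
  ext1 x
  exact map_zero (A.anchor x)

theorem liftSec_zero (ε : ℤˣ) : G.liftSec ε (0 : VField d M) = 0 := by
  ext x
  exact map_zero (G.lift ε x)

theorem leviCivita_zero_right (X : VField d M) : G.leviCivita X 0 = 0 := by
  have := G.leviCivita_sub_right X 0 0
  rwa [sub_self, sub_self] at this

theorem fluxVec_zero_right (X : VField d M) : G.fluxVec X 0 = 0 := by
  have := G.fluxVec_sub_left 0 0 X
  rw [sub_self, sub_self] at this
  rw [fluxVec_swap, this, neg_zero]

theorem canonicalPart_neg_liftSec (ε : ℤˣ) (u : Sec d F V) (Y : VField d M) :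
    G.canonicalPart (-ε) u (G.liftSec ε Y) = 0 := by
  simp only [canonicalPart, proj_neg_liftSec, map_zero, proj_zero, anch_zero,
    leviCivita_zero_right, fluxVec_zero_right, smul_zero, add_zero, liftSec_zero]

theorem canonicalZero_liftSec (ε : ℤˣ) (u : Sec d F V) (Y : VField d M) :
    G.canonicalZero u (G.liftSec ε Y) =
      G.proj ε (A.bracket (G.proj (-ε) u) (G.liftSec ε Y)) +
        G.liftSec ε (G.twistedConnection ε (G.anch (G.proj ε u)) Y) := by
  have h : G.canonicalZero u (G.liftSec ε Y) = G.canonicalPart ε u (G.liftSec ε Y) := by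
    have h0 := G.canonicalPart_neg_liftSec ε u Y
    rcases Int.units_eq_one_or ε with rfl | rfl
    · rw [canonicalZero, h0, add_zero]
    · rw [neg_neg] at h0
      rw [canonicalZero, h0, zero_add]
  rw [h, canonicalPart, proj_liftSec, anch_liftSec, twistedConnection]

theorem canonicalZero_liftSec_liftSec (ε : ℤˣ) (X Y : VField d M) :
    G.canonicalZero (G.liftSec ε X) (G.liftSec ε Y) =
      G.liftSec ε (G.twistedConnection ε X Y) := by
  rw [canonicalZero_liftSec, proj_neg_liftSec, proj_liftSec, anch_liftSec, map_zero,
    LinearMap.zero_apply, proj_zero, zero_add]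

theorem pairing_proj_liftSec (ε : ℤˣ) (u : Sec d F V) (Z : VField d M) (x : M) :
    A.pairing x (G.proj ε u x) (G.liftSec ε Z x) = A.pairing x (u x) (G.liftSec ε Z x) := by
  rw [proj_eq_projAt, pairing_projAt, G.projAt_of_mem_eigen (G.endo_liftSec ε Z x)]

theorem form_liftSec (ε : ℤˣ) (X Y : VField d M) (x : M) :
    G.form x (G.liftSec ε X x) (G.liftSec ε Y x) = G.metric x (X x) (Y x) := by
  rw [form, endo_liftSec, map_smul, smul_apply, liftSec_apply, liftSec_apply, pairing_lift_lift,
    smul_eq_mul, ← mul_assoc, sgn_mul_self, one_mul]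

end GeneralisedMetric

namespace ProlongationSection
open GeneralisedMetric
variable {A : ExactCourantAlgebroid d F V} {G : GeneralisedMetric A} (S : ProlongationSection G)

/-- The tensor on `TM` corresponding to the restriction of `S` to `E_±`. -/
noncomputable def field (ε : ℤˣ) (X Y : VField d M) : VField d M :=
  G.anch (S.apply (G.liftSec ε X) (G.liftSec ε Y))

/-- The connection on `TM` corresponding to the restriction of `D⁰ + S` to `E_±`. -/
noncomputable def fieldConnection (ε : ℤˣ) (X Y : VField d M) : VField d M :=
  G.twistedConnection ε X Y + S.field ε X Y

/-- The `E_{-ε}`-part of `u` contributes nothing, so on `E_ε` the tensor `S` is a tensor on `TM`. -/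
theorem apply_liftSec (ε : ℤˣ) (u : Sec d F V) (Y : VField d M) :
    S.apply u (G.liftSec ε Y) = G.liftSec ε (S.field ε (G.anch (G.proj ε u)) Y) := by
  have hY : ∀ x, G.liftSec ε Y x ∈ G.eigen ε x := fun x ↦ G.endo_liftSec ε Y x
  rw [field, liftSec_anch_proj, G.liftSec_anch (fun x ↦ S.apply_mem_eigen _ (hY x))]
  ext x
  have h1 : u x = G.proj ε u x + G.proj (-ε) u x :=
    congrArg (fun s : Sec d F V ↦ s x) (G.proj_add_proj_neg ε u).symm
  change S.toFun x (u x) _ = S.toFun x (G.proj ε u x) _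
  rw [h1, map_add, LinearMap.add_apply,
    S.apply_eq_zero_of_mem_eigen_neg (G.endo_proj (-ε) u x) (hY x), add_zero]

theorem connection_liftSec (ε : ℤˣ) (u : Sec d F V) (Y : VField d M) :
    S.connection u (G.liftSec ε Y) =
      G.proj ε (A.bracket (G.proj (-ε) u) (G.liftSec ε Y)) +
        G.liftSec ε (S.fieldConnection ε (G.anch (G.proj ε u)) Y) := by
  rw [connection, canonicalZero_liftSec, apply_liftSec, fieldConnection, liftSec_add, add_assoc]

theorem connection_liftSec_liftSec (ε : ℤˣ) (X Y : VField d M) :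
    S.connection (G.liftSec ε X) (G.liftSec ε Y) = G.liftSec ε (S.fieldConnection ε X Y) := by
  rw [connection_liftSec, proj_neg_liftSec, proj_liftSec, anch_liftSec, map_zero,
    LinearMap.zero_apply, proj_zero, zero_add]

namespace IsCanonical
variable {S} {e : Sec d F V}

theorem metric_field (hS : S.IsCanonical e) (hd : d ≠ 1) (ε : ℤˣ) (X Y Z : VField d M) (x : M) :
    G.metric x (S.field ε X Y x) (Z x) = sgn ε * (1 / ((d : ℝ) - 1)) *
      (G.metric x (X x) (Y x) * G.metric x (G.anch (G.proj ε e) x) (Z x) -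
        G.metric x (G.anch (G.proj ε e) x) (Y x) * G.metric x (X x) (Z x)) := by
  have h := hS.pairing_apply hd (G.endo_liftSec ε X x) (G.endo_liftSec ε Y x)
    (G.endo_liftSec ε Z x)
  have h2 : S.toFun x (G.liftSec ε X x) (G.liftSec ε Y x) =
      G.liftSec ε (S.field ε X Y) x := by
    have := S.apply_liftSec ε (G.liftSec ε X) Y
    rw [proj_liftSec, anch_liftSec] at this
    exact congrArg (fun s : Sec d F V ↦ s x) this
  rw [h2] at h
  simp only [liftSec_apply, pairing_lift_lift, pairing_proj_lift] at h
  rw [anch_apply]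
  have hs := sgn_mul_self ε
  set c := 1 / ((d : ℝ) - 1)
  linear_combination sgn ε * h + (c * sgn ε *
    (G.metric x (X x) (Y x) * G.metric x (A.anchor x (G.proj ε e x)) (Z x) -
        G.metric x (A.anchor x (G.proj ε e x)) (Y x) * G.metric x (X x) (Z x)) -
      G.metric x (S.field ε X Y x) (Z x)) * hs

theorem metric_field' (hS : S.IsCanonical e) (hd : d ≠ 1) (ε : ℤˣ) (X Y : VField d M) (x : M)
    (Z : TangentSpace (𝓡 d) x) :
    G.metric x (S.field ε X Y x) Z = sgn ε * (1 / ((d : ℝ) - 1)) *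
      (G.metric x (X x) (Y x) * G.metric x (G.anch (G.proj ε e) x) Z -
        G.metric x (G.anch (G.proj ε e) x) (Y x) * G.metric x (X x) Z) := by
  have h := hS.metric_field hd ε X Y (extendSec x Z) x
  rwa [extendSec_apply] at h

theorem field_skew (hS : S.IsCanonical e) (hd : d ≠ 1) (ε : ℤˣ) (X Y Z : VField d M) (x : M) :
    G.metric x (S.field ε X Y x) (Z x) = -G.metric x (Y x) (S.field ε X Z x) := by
  rw [G.metric_symm x (Y x), hS.metric_field hd, hS.metric_field hd]
  ring

theorem field_sub_left (hS : S.IsCanonical e) (hd : d ≠ 1) (ε : ℤˣ) (X X' Y : VField d M) :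
    S.field ε (X - X') Y = S.field ε X Y - S.field ε X' Y := by
  refine G.vfield_ext_metric fun x Z ↦ ?_
  simp only [ContMDiffSection.coe_sub, Pi.sub_apply, metric_sub_left, hS.metric_field' hd]
  ring

end IsCanonical

/-! ### The generalised Riemann tensor on one eigenbundle, and its expansion. -/

/-- The vector dual to the difference of `⟨(D⁰ + S)·,·⟩` on `E_±` and the `E_∓`-part of the
bracket, see `IsCanonical.pairing_connection`. -/
noncomputable def defect (G : GeneralisedMetric A) (ε : ℤˣ) (e : Sec d F V) (X Y : VField d M)
    (x : M) : TangentSpace (𝓡 d) x :=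
  (sgn ε * (1 / ((d : ℝ) - 1))) • (G.metric x (G.anch (G.proj ε e) x) (Y x) • X x -
    G.metric x (G.anch (G.proj ε e) x) (X x) • Y x) - (sgn ε / 3) • G.fluxVec X Y x

/-- The vector field underlying the `E_∓`-part of the bracket of two sections of `E_±`. -/
noncomputable def negBracket (G : GeneralisedMetric A) (ε : ℤˣ) (X Y : VField d M) : VField d M :=
  G.anch (G.proj (-ε) (A.bracket (G.liftSec ε X) (G.liftSec ε Y)))

/-- By `metric_anch_proj_neg_bracket`, `negBracket` is dual to `Z ↦ -g(∇^ε_Z X, Y)`. So `defect` is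
dual to `Z ↦ g((D - ∇^ε)_Z X, Y)`, and its flux coefficient is `ε/6 - ε/2 = -ε/3`. -/
theorem IsCanonical.metric_fieldConnection {S : ProlongationSection G} {e : Sec d F V}
    (hS : S.IsCanonical e) (hd : d ≠ 1) (ε : ℤˣ) (X Y Z : VField d M) (x : M) :
    G.metric x (S.fieldConnection ε Z X x) (Y x) =
      G.metric x (Z x) (defect G ε e X Y x - negBracket G ε X Y x) := by
  have h1 := G.metric_anch_proj_neg_bracket ε X Y Z x
  have h2 := G.metric_fluxVec X Y Z x
  have h3 := G.metric_fluxVec Z X Y x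
  rw [congrFun (G.flux_cyclic Z X Y) x] at h3
  rw [G.metric_symm x (Z x), negBracket, defect]
  rw [nablaPM_eq] at h1
  simp only [fieldConnection, twistedConnection, ContMDiffSection.coe_add, Pi.add_apply,
    smul_vfield_apply, metric_add_left, metric_sub_left, metric_smul_left, h3,
    hS.metric_field hd] at *
  rw [h1, h2, G.metric_symm x (X x) (Z x), G.metric_symm x (Y x) (Z x)]
  ring

/-- For fixed `X, Y` the pairing is linear in `u`; this exhibits the section of `E` representing it,
so that the trace over `E` becomes a single pairing of two such sections. -/
theorem IsCanonical.pairing_connection {S : ProlongationSection G} {e : Sec d F V}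
    (hS : S.IsCanonical e) (hd : d ≠ 1) (ε : ℤˣ) (u : Sec d F V) (X Y : VField d M) (x : M) :
    A.pairing x (S.connection u (G.liftSec ε X) x) (G.liftSec ε Y x) =
      A.pairing x (u x) (G.lift (-ε) x (negBracket G ε X Y x) +
        G.lift ε x (defect G ε e X Y x - negBracket G ε X Y x)) := by
  have h1 := G.metric_anch_proj_neg_bracket ε X Y (G.anch (G.proj (-ε) u)) x
  have h2 := G.metric_nablaPM ε (G.anch (G.proj (-ε) u)) X Y x
  rw [liftSec_anch_proj] at h2
  rw [connection_liftSec, ContMDiffSection.coe_add, Pi.add_apply, map_add, add_apply,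
    pairing_proj_liftSec, h2, liftSec_apply, liftSec_apply, pairing_lift_lift, map_add,
    pairing_proj_lift, pairing_proj_lift, hS.metric_fieldConnection hd, sgn_neg, ← anch_apply,
    ← anch_apply, G.metric_symm x _ (negBracket G ε X Y x)]
  rw [negBracket] at *
  rw [h1]
  ring

/-- The generalised Riemann tensor on `E_±` in terms of the connection on `TM`. -/
theorem IsCanonical.genRiemann_liftSec {S : ProlongationSection G} {e : Sec d F V}
    (hS : S.IsCanonical e) (hd : d ≠ 1) (ε : ℤˣ) (X Y Z W : VField d M) (x : M) :
    2 * (sgn ε * genRiemann A S.connection (G.liftSec ε W) (G.liftSec ε Z) (G.liftSec ε X)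
      (G.liftSec ε Y) x) =
      G.curvForm (S.fieldConnection ε) W Z X Y x + G.curvForm (S.fieldConnection ε) Y X Z W x +
        G.metric x (defect G ε e X Y x) (defect G ε e Z W x) := by
  have hb : ∀ X Y Z W : VField d M,
      A.pairing x (S.connection (A.bracket (G.liftSec ε X) (G.liftSec ε Y)) (G.liftSec ε Z) x)
        (G.liftSec ε W x) = sgn ε * (G.metric x (S.fieldConnection ε (lieBracket X Y) Z x) (W x) -
        G.metric x (negBracket G ε X Y x) (defect G ε e Z W x)) := by
    intro X Y Z W
    have h1 : G.anch (G.proj ε (A.bracket (G.liftSec ε X) (G.liftSec ε Y))) x =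
        lieBracket X Y x - negBracket G ε X Y x := by
      have h := congrArg (fun s : Sec d F V ↦ A.anchor x (s x))
        (G.proj_add_proj_neg ε (A.bracket (G.liftSec ε X) (G.liftSec ε Y)))
      simp only [ContMDiffSection.coe_add, Pi.add_apply, map_add, anchor_bracket_lift] at h
      exact eq_sub_of_add_eq h
    rw [hS.pairing_connection hd, hS.metric_fieldConnection hd, map_add, pairing_proj_lift,
      pairing_proj_lift, ← anch_apply, ← anch_apply, h1, sgn_neg, metric_sub_left,
      metric_sub_right, metric_sub_right, ← negBracket]
    ring
  have ht : traceE A (fun s t y ↦ A.pairing y (S.connection s (G.liftSec ε X) y) (G.liftSec ε Y y) *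
      A.pairing y (S.connection t (G.liftSec ε Z) y) (G.liftSec ε W y)) x =
      sgn ε * (G.metric x (defect G ε e X Y x - negBracket G ε X Y x)
        (defect G ε e Z W x - negBracket G ε Z W x) -
        G.metric x (negBracket G ε X Y x) (negBracket G ε Z W x)) := by
    simp only [traceE, hS.pairing_connection hd, extendSec_apply]
    simp only [A.pairing_symm x (frame d F V x _), A.pairing_symm x (coframe A x _)]
    rw [sum_frame_pairing]
    have m1 := fun P Q ↦ G.pairing_eigen_neg (G.endo_lift ε x P) (G.endo_lift (-ε) x Q)
    have m2 : ∀ P Q, A.pairing x (G.lift (-ε) x Q) (G.lift ε x P) = 0 := fun P Q ↦ by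
      rw [A.pairing_symm, m1]
    simp only [map_add, add_apply, pairing_lift_lift, m1, m2, sgn_neg]
    ring
  have hc : ∀ X Y Z W : VField d M,
      A.pairing x ((S.connection (G.liftSec ε X) (S.connection (G.liftSec ε Y) (G.liftSec ε Z)) -
        S.connection (G.liftSec ε Y) (S.connection (G.liftSec ε X) (G.liftSec ε Z)) -
        S.connection (A.bracket (G.liftSec ε X) (G.liftSec ε Y)) (G.liftSec ε Z)) x)
        (G.liftSec ε W x) = sgn ε * (G.curvForm (S.fieldConnection ε) W Z X Y x +
        G.metric x (negBracket G ε X Y x) (defect G ε e Z W x)) := by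
    intro X Y Z W
    simp only [connection_liftSec_liftSec, ContMDiffSection.coe_sub, Pi.sub_apply, map_sub,
      sub_apply, hb, curvForm, metric_sub_left]
    simp only [liftSec_apply, pairing_lift_lift]
    ring
  have hs := sgn_mul_self ε
  rw [genRiemann, hc, hc, ht]
  simp only [metric_sub_left, metric_sub_right]
  rw [G.metric_symm x (negBracket G ε Z W x)]
  -- The terms containing `negBracket` cancel: those of the trace that are quadratic in it among
  -- themselves, and the mixed ones against the two terms `D_{[v,w]}` and `D_{[b,a]}`.
  linear_combination (G.curvForm (S.fieldConnection ε) W Z X Y x +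
    G.curvForm (S.fieldConnection ε) Y X Z W x +
        G.metric x (defect G ε e X Y x) (defect G ε e Z W x)) * hs

/-- Here the base connection is `∇ + (ε/6) H`, whose torsion `(ε/3) H` contributes a further term
linear in `S`. -/
theorem IsCanonical.curvForm_fieldConnection {S : ProlongationSection G} {e : Sec d F V}
    (hS : S.IsCanonical e) (hd : d ≠ 1) (ε : ℤˣ) (X Y Z W : VField d M) (x : M) :
    G.curvForm (S.fieldConnection ε) W Z X Y x =
      G.curvForm (G.twistedConnection ε) W Z X Y x +
      G.covDerivTensor (G.twistedConnection ε) (S.field ε) X Y Z W x -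
      G.covDerivTensor (G.twistedConnection ε) (S.field ε) Y X Z W x +
      G.metric x (S.field ε ((sgn ε / 3) • G.fluxVec X Y) Z x) (W x) -
      G.metric x (S.field ε Y Z x) (S.field ε X W x) +
      G.metric x (S.field ε X Z x) (S.field ε Y W x) := by
  rw [← G.twistedConnection_torsion]
  exact G.curvForm_add (G.metric_twistedConnection ε) (hS.field_skew hd ε)
    (hS.field_sub_left hd ε) X Y Z W x

/-- On `E_ε`, the form `χ` is `ε(d - 1)` times the form of `S`, and `D⁰` along `E_ε` is the twisted
connection, so the two Leibniz expansions match term by term. -/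
theorem IsCanonical.covDerivForm_chiForm {S : ProlongationSection G} {e : Sec d F V}
    (hS : S.IsCanonical e) (hd : d ≠ 1) (ε : ℤˣ) (X Y Z W : VField d M) (x : M) :
    sgn ε * (1 / ((d : ℝ) - 1)) * covDerivForm A G.canonicalZero (G.chiForm ε e) (G.liftSec ε X)
      (G.liftSec ε Y) (G.liftSec ε Z) (G.liftSec ε W) x =
      G.covDerivTensor (G.twistedConnection ε) (S.field ε) X Y Z W x := by
  have hd' : (d : ℝ) - 1 ≠ 0 := sub_ne_zero.2 (by exact_mod_cast hd)
  have hs := sgn_mul_self ε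
  have h : ∀ (Y Z W : VField d M) (y : M), G.chiForm ε e y (G.liftSec ε Y y) (G.liftSec ε Z y)
      (G.liftSec ε W y) = (sgn ε * ((d : ℝ) - 1)) * G.metric y (S.field ε Y Z y) (W y) := by
    intro Y Z W y
    have h1 : ∀ P : VField d M, A.pairing y (G.projAt ε y (e y)) (G.liftSec ε P y) =
        sgn ε * G.metric y (G.anch (G.proj ε e) y) (P y) := by
      intro P
      rw [← proj_eq_projAt, pairing_proj_liftSec, liftSec_apply, pairing_proj_lift, anch_apply]
    rw [chiForm, chi, G.projAt_of_mem_eigen (G.endo_liftSec ε Y y),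
      G.projAt_of_mem_eigen (G.endo_liftSec ε Z y), hS.metric_field hd]
    simp only [map_sub, map_smul, sub_apply, smul_apply, smul_eq_mul, h1]
    simp only [liftSec_apply, pairing_lift_lift]
    field_simp
  rw [covDerivForm, covDerivTensor]
  simp only [canonicalZero_liftSec_liftSec, h, anchor_liftSec]
  rw [dirDeriv_const_mul (G.mdifferentiableAt_metric _ _ x)]
  set a := dirDeriv (fun y ↦ G.metric y (S.field ε Y Z y) (W y)) x (X x)
  field_simp
  linear_combination (a - G.metric x (S.field ε (G.twistedConnection ε X Y) Z x) (W x) -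
    G.metric x (S.field ε Y (G.twistedConnection ε X Z) x) (W x) -
    G.metric x (S.field ε Y Z x) (G.twistedConnection ε X W x)) * hs

/-- The torsion terms `S_{H(X,Y)}` and `S_{H(Z,W)}` cancel the mixed products in `g(δ, δ)`. Of the
flux only the square of `-ε/3` remains, giving `1/9`. Each curvature supplies one copy of the term
in `g(e_ε, e_ε)`, hence the factor `2`. -/
theorem IsCanonical.quadratic {S : ProlongationSection G} {e : Sec d F V}
    (hS : S.IsCanonical e) (hd : d ≠ 1) (ε : ℤˣ) (X Y Z W : VField d M) (x : M) :
    (G.metric x (S.field ε ((sgn ε / 3) • G.fluxVec X Y) Z x) (W x) -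
      G.metric x (S.field ε Y Z x) (S.field ε X W x) +
      G.metric x (S.field ε X Z x) (S.field ε Y W x)) +
    (G.metric x (S.field ε ((sgn ε / 3) • G.fluxVec Z W) X x) (Y x) -
      G.metric x (S.field ε W X x) (S.field ε Z Y x) +
      G.metric x (S.field ε Z X x) (S.field ε W Y x)) +
    G.metric x (defect G ε e X Y x) (defect G ε e Z W x) =
    (1 / 9) * G.flux2 X Y Z W x + (1 / ((d : ℝ) - 1)) ^ 2 *
      (2 * G.metric x (G.anch (G.proj ε e) x) (G.anch (G.proj ε e) x) *
            (G.metric x (Y x) (W x) * G.metric x (X x) (Z x)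
              - G.metric x (X x) (W x) * G.metric x (Y x) (Z x))
          + G.metric x (W x) (G.anch (G.proj ε e) x) *
            (G.metric x (Y x) (Z x) * G.metric x (X x) (G.anch (G.proj ε e) x)
              - G.metric x (X x) (Z x) * G.metric x (Y x) (G.anch (G.proj ε e) x))
          + G.metric x (Z x) (G.anch (G.proj ε e) x) *
            (G.metric x (X x) (W x) * G.metric x (Y x) (G.anch (G.proj ε e) x)
              - G.metric x (Y x) (W x) * G.metric x (X x) (G.anch (G.proj ε e) x))) := by
  have m : ∀ (P : TangentSpace (𝓡 d) x) (Q R : VField d M), G.metric x P (S.field ε Q R x) =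
      G.metric x (S.field ε Q R x) P := fun P Q R ↦ G.metric_symm x _ _
  have k : ∀ (P : TangentSpace (𝓡 d) x) (Q R : VField d M), G.metric x P (G.fluxVec Q R x) =
      G.metric x (G.fluxVec Q R x) P := fun P Q R ↦ G.metric_symm x _ _
  simp only [defect, hS.metric_field' hd, m, smul_vfield_apply, metric_smul_left,
    metric_smul_right, metric_sub_left, metric_sub_right, flux2]
  rw [k (X x), k (Y x)]
  rw [G.metric_symm x (X x) (G.anch (G.proj ε e) x), G.metric_symm x (Y x) (G.anch (G.proj ε e) x),
    G.metric_symm x (Z x) (G.anch (G.proj ε e) x), G.metric_symm x (W x) (G.anch (G.proj ε e) x),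
    G.metric_symm x (Z x) (X x), G.metric_symm x (Z x) (Y x), G.metric_symm x (W x) (X x),
    G.metric_symm x (W x) (Y x), G.metric_symm x (Y x) (X x), G.metric_symm x (W x) (Z x)]
  set c := 1 / ((d : ℝ) - 1)
  rcases Int.units_eq_one_or ε with rfl | rfl
  · simp only [sgn, Units.val_one, Int.cast_one]
    ring
  · simp only [sgn, Units.val_neg, Units.val_one, Int.reduceNeg, Int.cast_neg, Int.cast_one]
    ring

end ProlongationSection

end
end GenGeom

/-! ### The main theorem. -/

theorem mainTheorem3 {d : ℕ} (hd : d ≠ 1) {M : Type*} [TopologicalSpace M] [T2Space M]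
    [ChartedSpace (EuclideanSpace ℝ (Fin d)) M] [IsManifold (𝓡 d) ∞ M]
    {F : Type*} [NormedAddCommGroup F] [NormedSpace ℝ F] [FiniteDimensional ℝ F]
    {V : M → Type*} [TopologicalSpace (TotalSpace F V)] [∀ x, AddCommGroup (V x)]
    [∀ x, Module ℝ (V x)] [∀ x, TopologicalSpace (V x)]
    [∀ x, IsTopologicalAddGroup (V x)] [∀ x, ContinuousSMul ℝ (V x)]
    [FiberBundle F V] [VectorBundle ℝ F V] [ContMDiffVectorBundle ∞ F V (𝓡 d)]
    (A : GenGeom.ExactCourantAlgebroid d F V) (G : GenGeom.GeneralisedMetric A)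
    (e : GenGeom.Sec d F V) (S : GenGeom.ProlongationSection G) (hS : S.IsCanonical e)
    (ε : ℤˣ) (a b v w : GenGeom.Sec d F V)
    (ha : ∀ x, a x ∈ G.eigen ε x) (hb : ∀ x, b x ∈ G.eigen ε x)
    (hv : ∀ x, v x ∈ G.eigen ε x) (hw : ∀ x, w x ∈ G.eigen ε x) (x : M) :
    GenGeom.GeneralisedMetric.sgn ε * GenGeom.genRiemann A S.connection a b v w x =
      G.riemann (G.anch a) (G.anch b) (G.anch v) (G.anch w) x
      - 1 / 36 * G.flux2 (G.anch a) (G.anch v) (G.anch b) (G.anch w) x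
      - 1 / 36 * G.flux2 (G.anch b) (G.anch v) (G.anch w) (G.anch a) x
      - 1 / 18 * G.flux2 (G.anch v) (G.anch w) (G.anch a) (G.anch b) x
      + GenGeom.GeneralisedMetric.sgn ε * (1 / (2 * ((d : ℝ) - 1))) *
        (GenGeom.covDerivForm A G.canonicalZero (G.chiForm ε e) v w b a x
          - GenGeom.covDerivForm A G.canonicalZero (G.chiForm ε e) w v b a x
          + GenGeom.covDerivForm A G.canonicalZero (G.chiForm ε e) b a v w x
          - GenGeom.covDerivForm A G.canonicalZero (G.chiForm ε e) a b v w x)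
      + 1 / (2 * ((d : ℝ) - 1) ^ 2) *
        (2 * G.form x (G.proj ε e x) (G.proj ε e x) *
            (G.form x (w x) (a x) * G.form x (v x) (b x)
              - G.form x (v x) (a x) * G.form x (w x) (b x))
          + G.form x (a x) (G.proj ε e x) *
            (G.form x (w x) (b x) * G.form x (v x) (G.proj ε e x)
              - G.form x (v x) (b x) * G.form x (w x) (G.proj ε e x))
          + G.form x (b x) (G.proj ε e x) *
            (G.form x (v x) (a x) * G.form x (w x) (G.proj ε e x)
              - G.form x (w x) (a x) * G.form x (v x) (G.proj ε e x))) := by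
  obtain ⟨X, rfl⟩ : ∃ X, v = G.liftSec ε X := ⟨G.anch v, (G.liftSec_anch hv).symm⟩
  obtain ⟨Y, rfl⟩ : ∃ Y, w = G.liftSec ε Y := ⟨G.anch w, (G.liftSec_anch hw).symm⟩
  obtain ⟨Z, rfl⟩ : ∃ Z, b = G.liftSec ε Z := ⟨G.anch b, (G.liftSec_anch hb).symm⟩
  obtain ⟨W, rfl⟩ : ∃ W, a = G.liftSec ε W := ⟨G.anch a, (G.liftSec_anch ha).symm⟩
  have h := hS.genRiemann_liftSec hd ε X Y Z W x
  rw [hS.curvForm_fieldConnection hd, hS.curvForm_fieldConnection hd] at h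
  have h1 := G.curvForm_twistedConnection_add ε X Y Z W x
  have h2 := hS.quadratic hd ε X Y Z W x
  have c1 := hS.covDerivForm_chiForm hd ε X Y Z W x
  have c2 := hS.covDerivForm_chiForm hd ε Y X Z W x
  have c3 := hS.covDerivForm_chiForm hd ε Z W X Y x
  have c4 := hS.covDerivForm_chiForm hd ε W Z X Y x
  -- The product of the defects yields `+1/9 H^(2)(v,w,b,a)`; exchanging `a` and `b` and halving
  -- gives the coefficient `-1/18`.
  have f2 : G.flux2 X Y W Z x = -G.flux2 X Y Z W x := by
    simp only [GenGeom.GeneralisedMetric.flux2, G.fluxVec_swap Z W]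
    exact G.metric_neg_right _ _ _
  have k1 : 1 / (2 * ((d : ℝ) - 1)) = (1 / 2) * (1 / ((d : ℝ) - 1)) := by rw [one_div_mul_one_div]
  have k2 : 1 / (2 * ((d : ℝ) - 1) ^ 2) = (1 / 2) * (1 / ((d : ℝ) - 1)) ^ 2 := by
    rw [one_div_pow, one_div_mul_one_div]
  -- With `e_ε` written as a lift, every value of `𝒢` becomes a value of `g`.
  rw [← G.liftSec_anch_proj ε e]
  simp only [G.form_liftSec, G.anch_liftSec]
  rw [f2, k1, k2]
  linear_combination (1 / 2) * (h + h1 + h2 - c1 + c2 - c3 + c4)
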